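/- Let $\Sigma$ be a finite alphabet and $L\subseteq\Sigma^*$ a language. The following two properties are equivalent. 1. $L$ is an unambiguous context-sensitive language, i.e. $L\in\mathrm{USPACE}(n)$: $L$ does not contain the empty word, and there is a nondeterministic (one-tape) Turing machine, halting when it enters an accepting state, that accepts $L$, works in linear space (for some constant $k$, every computation on an input of length $n$ stays within $k(n+1)$ tape cells of the initial head position), and is unambiguous (each accepted word has exactly one accepting computation). 2. There are a finite alphabet $\Gamma$, a rational graph $G=(T_a)_{a\in\Sigma}$ labelled by $\Sigma$ with vertices in $\Gamma^*$ whose transducers $T_a$ are all unambiguous, and two rational languages $I,F\subseteq\Gamma^*$, such that $G$ is unambiguous with respect to $I$ and $F$ and $L=L(G,I,F)$. Here a transducer over $\Gamma$ is a finite automaton with one initial state, a set of final states, and transitions labelled in $(\Gamma\cup\{\varepsilon\})\times(\Gamma\cup\{\varepsilon\})$. It accepts $(u,v)\in\Gamma^*\times\Gamma^*$ if some run from the initial state to a final state has label (the componentwise concatenation of the labels of its transitions) equal to $(u,v)$; it is unambiguous if each accepted pair has exactly one accepting run. The graph $G$ has an edge $u\xrightarrow{a}v$ if and only if $T_a$ accepts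 $(u,v)$. A path is a nonempty sequence of consecutive edges, labelled by the word of its edge labels; $L(G,I,F)$ is the set of labels of paths from a vertex in $I$ to a vertex in $F$; and $G$ is unambiguous with respect to $I$ and $F$ if each word of $L(G,I,F)$ labels exactly one path from a vertex in $I$ to a vertex in $F$. -/

import Mathlib

namespace RatGraph

universe u v

/-! ### Labelled graphs and paths -/

/-- `IsPath E s p t`: the list `p` of edges (source, label, target) of the labelled simple
directed graph `E` is a path from `s` to `t`; the empty list is a path from `s` to `s`. -/
def IsPath {V : Type u} {A : Type v} (E : Set (V × A × V)) : V → List (V × A × V) → V → Prop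
  | s, [], t => s = t
  | s, e :: p, t => e ∈ E ∧ e.1 = s ∧ IsPath E e.2.2 p t

/-- `p` is a path (with at least one edge) labelled by `w`, from a vertex of `I` to a vertex
of `F`. -/
def IsPathFor {V : Type u} {A : Type v} (E : Set (V × A × V)) (I F : Set V) (w : List A)
    (p : List (V × A × V)) : Prop :=
  p ≠ [] ∧ p.map (fun e => e.2.1) = w ∧ ∃ s ∈ I, ∃ t ∈ F, IsPath E s p t

/-- The path language `L(E, I, F)`. -/
def pathLanguage {V : Type u} {A : Type v} (E : Set (V × A × V)) (I F : Set V) : Language A :=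
  {w | ∃ p, IsPathFor E I F w p}

/-- `E` is unambiguous with respect to `I` and `F`: each word of `L(E, I, F)` labels exactly one
path from `I` to `F`. -/
def GraphUnambiguous {V : Type u} {A : Type v} (E : Set (V × A × V)) (I F : Set V) : Prop :=
  ∀ w ∈ pathLanguage E I F, ∃! p, IsPathFor E I F w p

/-! ### Transducers -/

/-- A transducer over `Γ`: a finite automaton over `Γ* × Γ*` whose labels are pairs in
`(Γ ∪ {ε}) × (Γ ∪ {ε})`; `none` stands for `ε`. -/
structure Transducer (Γ : Type) where
  Q : Type
  finQ : Finite Q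
  start : Q
  final : Set Q
  trans : Set (Q × (Option Γ × Option Γ) × Q)

namespace Transducer

variable {Γ : Type} (T : Transducer Γ)

/-- A run `r` (a possibly empty sequence of transitions) from the start state to a final state
whose label, the product of its transition labels in `Γ* × Γ*`, is `(x, y)`. -/
def AcceptingRun (x y : List Γ) (r : List (T.Q × (Option Γ × Option Γ) × T.Q)) : Prop :=
  (∃ q ∈ T.final, IsPath T.trans T.start r q) ∧
    r.filterMap (fun e => e.2.1.1) = x ∧ r.filterMap (fun e => e.2.1.2) = y

/-- `T` accepts the pair `(x, y)`. -/
def Accepts (x y : List Γ) : Prop := ∃ r, T.AcceptingRun x y r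

/-- Each accepted pair has exactly one accepting run. -/
def Unambiguous : Prop := ∀ x y, T.Accepts x y → ∃! r, T.AcceptingRun x y r

end Transducer

/-! ### Rational graphs -/

/-- A rational graph labelled by `α` with vertices in `Γ*`, given by one transducer over `Γ` for
each label. -/
def RationalGraph (α : Type u) (Γ : Type) : Type (max u 1) := α → Transducer Γ

/-- The edges of a rational graph. -/
def RationalGraph.edges {α : Type u} {Γ : Type} (G : RationalGraph α Γ) :
    Set (List Γ × α × List Γ) :=
  {e | (G e.2.1).Accepts e.1 e.2.2}

/-! ### Nondeterministic Turing machines in linear space -/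

/-- Head moves. -/
inductive Move : Type
  | left
  | stay
  | right

/-- The displacement of the head. -/
def Move.shift : Move → ℤ
  | .left => -1
  | .stay => 0
  | .right => 1

/-- A nondeterministic Turing machine with one two-way infinite tape and input alphabet `α`
(embedded in the tape alphabet by `input`). It halts on accepting. -/
structure Machine (α : Type u) where
  Q : Type
  finQ : Finite Q
  Γ : Type
  finΓ : Finite Γ
  input : α → Γ
  input_injective : Function.Injective input
  blank : Γ
  blank_notMem : blank ∉ Set.range input
  start : Q
  accept : Set Q
  trans : Q → Γ → Set (Q × Γ × Move)
  accept_halts : ∀ q ∈ accept, ∀ a, trans q a = ∅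

namespace Machine

variable {α : Type u} (M : Machine α)

/-- Configurations: state, head position, tape content. -/
structure Config where
  state : M.Q
  head : ℤ
  tape : ℤ → M.Γ

/-- The initial configuration on `w`: the cells `0, …, |w| - 1` hold `w`, the others are blank,
and the head is on cell `0`. -/
def initialConfig (w : List α) : M.Config where
  state := M.start
  head := 0
  tape := fun i => if 0 ≤ i then (w.map M.input).getD i.toNat M.blank else M.blank

/-- One computation step. -/
def Step (c c' : M.Config) : Prop :=
  ∃ t ∈ M.trans c.state (c.tape c.head),
    c' = ⟨t.1, c.head + t.2.2.shift, Function.update c.tape c.head t.2.1⟩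

/-- The list of configurations `r` is an accepting computation on `w`. -/
def AcceptingRun (w : List α) (r : List M.Config) : Prop :=
  r.head? = some (M.initialConfig w) ∧ r.IsChain M.Step ∧
    ∃ c, r.getLast? = some c ∧ c.state ∈ M.accept

/-- The language accepted by `M`. -/
def language : Language α := {w | ∃ r, M.AcceptingRun w r}

/-- Each accepted word has exactly one accepting computation. -/
def Unambiguous : Prop := ∀ w ∈ M.language, ∃! r, M.AcceptingRun w r

/-- `M` works in linear space: for some constant `k`, no computation on an input of length `n`
(accepting or not) brings the head further than `k * (n + 1)` cells away from its initial
position. -/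
def LinearSpace : Prop :=
  ∃ k : ℕ, ∀ (w : List α) (c : M.Config),
    Relation.ReflTransGen M.Step (M.initialConfig w) c → |c.head| ≤ (k : ℤ) * (w.length + 1)

end Machine

/-- Unambiguous context-sensitive languages, `USPACE(n)`: the languages without the empty word
that are accepted by an unambiguous linearly bounded machine. -/
def IsUnambiguousContextSensitive {α : Type u} (L : Language α) : Prop :=
  [] ∉ L ∧ ∃ M : Machine α, M.LinearSpace ∧ M.Unambiguous ∧ M.language = L

end RatGraph

/-! From a graph to a machine. The vertices on a path labelled by `w` may be arbitrarily long, so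
the tape does not hold them: it holds one transducer state per letter of `w`, and the vertices are
streamed through the cells. The last vertex is guessed letter by letter at the right end, where the
automaton of `F` reads it. Each guessed letter is demanded of the cell on its left, whose transducer
runs until it writes that letter. The letters which this run reads are demanded of the next cell,
and so on down to the left end, where the automaton of `I` reads them. A cell remembers at most one
unanswered demand, so the space is linear.

An accepting computation is determined by the transitions fired at each cell and the guessed word
(`Cascade.Follows.unique`), and these data are accepting transducer runs along a path from `I` to
`F` (`Cascade.ZRun.exists_path`). Unambiguity of the graph fixes the path, and unambiguity of the
transducers fixes the runs.

From a machine to a graph. A path with `n` edges has `n + 1` vertices, so the tape is folded into `n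
+ 1` columns: cell `i` lies in column `i % (n + 1)` on track `i / (n + 1)`, and vertex `j` is the
history of column `j` during an accepting computation. A synchronous transducer compares
neighbouring columns, while `I` and `F` check the first and the last one. No transducer sees the
head pass between the last column and the first. But every letter carries the current track, on
which all columns agree; the first column changes it according to its own head mark and the last
column according to its own, so agreement forces the head to wrap around
(`Machine.exists_step_of_rowStep`). Hence the paths from `I` to `F` are exactly the encodings of
accepting computations (`Machine.isPathFor_iff`). -/

namespace RatGraph

/-! ### Paths -/

section Paths

variable {V A : Type*} {E : Set (V × A × V)}

theorem isPath_cons {s t : V} {e : V × A × V} {p : List (V × A × V)} :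
    IsPath E s (e :: p) t ↔ e ∈ E ∧ e.1 = s ∧ IsPath E e.2.2 p t := Iff.rfl

theorem IsPath.target_unique {s t t' : V} {p : List (V × A × V)}
    (h : IsPath E s p t) (h' : IsPath E s p t') : t = t' := by
  induction p generalizing s with
  | nil => exact h.symm.trans h'
  | cons e p ih => exact ih h.2.2 h'.2.2

theorem IsPath.source_unique {s s' t t' : V} {p : List (V × A × V)} (hp : p ≠ [])
    (h : IsPath E s p t) (h' : IsPath E s' p t') : s = s' := by
  cases p with
  | nil => exact absurd rfl hp
  | cons e p => exact h.2.1.symm.trans h'.2.1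

end Paths

/-! ### Accepting runs of machines, as lists of successive configurations -/

namespace Machine

variable {α : Type*} (M : Machine α)

/-- `r` lists the configurations following `c` in an accepting computation from `c`. -/
def RunFrom : M.Config → List M.Config → Prop
  | c, [] => c.state ∈ M.accept
  | c, c' :: r => M.Step c c' ∧ RunFrom c' r

theorem runFrom_iff (c : M.Config) (r : List M.Config) :
    M.RunFrom c r ↔ (c :: r).IsChain M.Step ∧
      ∃ d, (c :: r).getLast? = some d ∧ d.state ∈ M.accept := by
  induction r generalizing c with
  | nil => simp [RunFrom]
  | cons c' r ih =>
    rw [RunFrom, ih, List.isChain_cons_cons, List.getLast?_cons_cons, and_assoc]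

theorem acceptingRun_cons_iff (w : List α) (c : M.Config) (r : List M.Config) :
    M.AcceptingRun w (c :: r) ↔ c = M.initialConfig w ∧ M.RunFrom c r := by
  rw [AcceptingRun, runFrom_iff, List.head?_cons, Option.some_inj]

theorem acceptingRun_iff (w : List α) (r : List M.Config) :
    M.AcceptingRun w r ↔ ∃ r', r = M.initialConfig w :: r' ∧ M.RunFrom (M.initialConfig w) r' := by
  cases r with
  | nil => simp [AcceptingRun]
  | cons c r =>
    rw [acceptingRun_cons_iff]
    constructor
    · rintro ⟨rfl, h⟩
      exact ⟨r, rfl, h⟩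
    · rintro ⟨r', h, h'⟩
      cases h
      exact ⟨rfl, h'⟩

theorem mem_language_iff (w : List α) :
    w ∈ M.language ↔ ∃ r, M.RunFrom (M.initialConfig w) r := by
  change (∃ r, M.AcceptingRun w r) ↔ _
  simp_rw [acceptingRun_iff]
  exact ⟨fun ⟨_, r, _, h⟩ => ⟨r, h⟩, fun ⟨r, h⟩ => ⟨_, r, rfl, h⟩⟩

theorem unambiguous_iff : M.Unambiguous ↔ ∀ w r r', M.RunFrom (M.initialConfig w) r →
    M.RunFrom (M.initialConfig w) r' → r = r' := by
  constructor
  · intro h w r r' hr hr'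
    have := (h w ((M.mem_language_iff w).2 ⟨r, hr⟩)).unique
      ((M.acceptingRun_iff w _).2 ⟨r, rfl, hr⟩) ((M.acceptingRun_iff w _).2 ⟨r', rfl, hr'⟩)
    exact (List.cons.inj this).2
  · rintro h w ⟨r, hr⟩
    refine ⟨r, hr, fun r' hr' => ?_⟩
    obtain ⟨s, rfl, hs⟩ := (M.acceptingRun_iff w _).1 hr
    obtain ⟨s', rfl, hs'⟩ := (M.acceptingRun_iff w _).1 hr'
    rw [h w s s' hs hs']

end Machine

/-! ### Simulation of a rational graph by a machine

The tape holds one transducer state per letter of the input word. The machine advances all the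
transducers along a path of the graph simultaneously, on demand: the rightmost vertex of the path is
guessed letter by letter, and each transducer that has to output a letter runs until it does,
demanding the letters that it reads from its left neighbour. -/

/-- Transducers sharing their states, final states and transitions, together with automata
for the initial and for the final vertices. -/
structure Cascade (Γ Q σ τ : Type) where
  final : Set Q
  trans : Set (Q × (Option Γ × Option Γ) × Q)
  source : DFA Γ σ
  target : DFA Γ τ

namespace Cascade

/-- A cell holds the state of a transducer and a demand to which it will have to return: `some none`
stands for the demand of the end of the word, and `none` for no demand. -/
abbrev Cell (Γ Q : Type) : Type := Q × Option (Option Γ)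

/-- The control states. `down i f r` demands `r` from the left, where `r = none` stands for the end
of the word, `up i f` delivers to the right; `i` and `f` are the states of the automata for the
initial and final vertices. -/
inductive Control (Γ σ τ : Type) : Type
  | start
  | down (i : σ) (f : τ) (r : Option Γ)
  | up (i : σ) (f : τ)
  | accepted

instance {Γ σ τ : Type} [Finite Γ] [Finite σ] [Finite τ] : Finite (Control Γ σ τ) := by
  let g : Option (Option ((σ × τ) × Option (Option Γ))) → Control Γ σ τ
    | none => .start
    | some none => .accepted
    | some (some ((i, f), none)) => .up i f
    | some (some ((i, f), some r)) => .down i f r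
  refine Finite.of_surjective g ?_
  rintro (_ | ⟨i, f, r⟩ | ⟨i, f⟩ | _)
  · exact ⟨none, rfl⟩
  · exact ⟨some (some ((i, f), some r)), rfl⟩
  · exact ⟨some (some ((i, f), none)), rfl⟩
  · exact ⟨some none, rfl⟩

variable {Γ Q σ τ : Type} (D : Cascade Γ Q σ τ)

/-- The control after a transition reading `u`. -/
def Control.afterRead (i : σ) (f : τ) : Option Γ → Control Γ σ τ
  | none => .up i f
  | some x => .down i f (some x)

/-- The demand left in a cell after a transition writing `v` in answer to the demand `r`. -/
def pending (r : Option Γ) : Option Γ → Option (Option Γ)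
  | none => some r
  | some _ => none

/-- A configuration: the cells to the left (nearest first), the control state, and the cells to the
right. -/
structure Zipper (Γ Q σ τ : Type) : Type where
  left : List (Cell Γ Q)
  control : Control Γ σ τ
  right : List (Cell Γ Q)

/-- The steps of the simulation. -/
inductive ZStep : Zipper Γ Q σ τ → Zipper Γ Q σ τ → Prop
  | start (l q ρ) : ZStep ⟨l, .start, (q, none) :: ρ⟩
      ⟨(q, none) :: l, .up D.source.start D.target.start, ρ⟩
  | pass (l i f q ρ) : ZStep ⟨l, .up i f, (q, none) :: ρ⟩ ⟨(q, none) :: l, .up i f, ρ⟩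
  | resume (l i f q r ρ) : ZStep ⟨l, .up i f, (q, some r) :: ρ⟩ ⟨(q, none) :: l, .down i f r, ρ⟩
  | guess (l i f x) : ZStep ⟨l, .up i f, []⟩ ⟨l, .down i (D.target.step f x) (some x), []⟩
  | close (l i f) (hf : f ∈ D.target.accept) : ZStep ⟨l, .up i f, []⟩ ⟨l, .down i f none, []⟩
  | fire (l i f r ρ q p u v q') (ht : (q, (u, v), q') ∈ D.trans) (hv : v = none ∨ v = r) :
      ZStep ⟨(q, p) :: l, .down i f r, ρ⟩ ⟨l, .afterRead i f u, (q', pending r v) :: ρ⟩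
  | finish (l i f q p ρ) (hq : q ∈ D.final) :
      ZStep ⟨(q, p) :: l, .down i f none, ρ⟩ ⟨l, .down i f none, (q, p) :: ρ⟩
  | supply (i f x ρ) : ZStep ⟨[], .down i f (some x), ρ⟩ ⟨[], .up (D.source.step i x) f, ρ⟩
  | accept (i f ρ) (hi : i ∈ D.source.accept) :
      ZStep ⟨[], .down i f none, ρ⟩ ⟨[], .accepted, ρ⟩

/-- `r` lists the configurations following `z` in an accepting computation from `z`. -/
def ZRun : Zipper Γ Q σ τ → List (Zipper Γ Q σ τ) → Prop
  | z, [] => z.control = .accepted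
  | z, z' :: r => D.ZStep z z' ∧ ZRun z' r

abbrev Reach : Zipper Γ Q σ τ → Zipper Γ Q σ τ → Prop := Relation.ReflTransGen D.ZStep

theorem exists_zRun_of_reach {z z' : Zipper Γ Q σ τ} (h : D.Reach z z')
    (hz : z'.control = .accepted) : ∃ r, D.ZRun z r := by
  induction h using Relation.ReflTransGen.head_induction_on with
  | refl => exact ⟨[], hz⟩
  | head h _ ih =>
    obtain ⟨r, hr⟩ := ih
    exact ⟨_ :: r, h, hr⟩

/-! #### Existence of accepting computations -/

/-- The word read along a sequence of transitions. -/
def input (ρ : List (Q × (Option Γ × Option Γ) × Q)) : List Γ := ρ.filterMap fun e => e.2.1.1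

/-- The word written along a sequence of transitions. -/
def output (ρ : List (Q × (Option Γ × Option Γ) × Q)) : List Γ := ρ.filterMap fun e => e.2.1.2

theorem input_cons (q q' : Q) (u v : Option Γ) (ρ : List (Q × (Option Γ × Option Γ) × Q)) :
    input ((q, (u, v), q') :: ρ) = u.toList ++ input ρ := by
  cases u <;> rfl

theorem output_cons (q q' : Q) (u v : Option Γ) (ρ : List (Q × (Option Γ × Option Γ) × Q)) :
    output ((q, (u, v), q') :: ρ) = v.toList ++ output ρ := by
  cases v <;> rfl

/-- `ρ` is a run from `q` to a final state. -/
def Terminates (q : Q) (ρ : List (Q × (Option Γ × Option Γ) × Q)) : Prop :=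
  ∃ q' ∈ D.final, IsPath D.trans q ρ q'

/-- The cells `l` can still deliver the word `y`, and then its end. -/
def Delivers (i : σ) : List (Cell Γ Q) → List Γ → Prop
  | [], y => D.source.evalFrom i y ∈ D.source.accept
  | c :: l, y => ∃ ρ, D.Terminates c.1 ρ ∧ output ρ = y ∧ Delivers i l (input ρ)

/-- Outer induction on the number of cells, inner induction on the remaining run of the nearest
cell: transitions that write nothing are fired one after another, the demand waiting in the cell
meanwhile, until one writes `x`. -/
theorem Delivers.reach_up {i : σ} {l : List (Cell Γ Q)} {x : Γ} {y : List Γ}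
    (h : D.Delivers i l (x :: y)) (f : τ) (R : List (Cell Γ Q)) :
    ∃ i' l', D.Reach ⟨l, .down i f (some x), R⟩ ⟨l', .up i' f, R⟩ ∧ D.Delivers i' l' y ∧
      l'.length = l.length := by
  generalize hn : l.length = n
  induction n generalizing i l x y R with
  | zero =>
    obtain rfl := List.length_eq_zero_iff.1 hn
    exact ⟨_, [], .single (.supply i f x R), h, rfl⟩
  | succ n ih =>
    obtain ⟨⟨q, p⟩, l, rfl⟩ := List.exists_cons_of_length_eq_add_one hn
    obtain ⟨ρ, hq, hy, hl⟩ := h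
    replace hn : l.length = n := Nat.succ.inj hn
    induction ρ generalizing i q p l with
    | nil => cases hy
    | cons t ρ ihρ =>
      obtain ⟨q₀, ⟨u, v⟩, q'⟩ := t
      obtain ⟨qf, hqf, ht, rfl, hρ⟩ := hq
      rw [input_cons] at hl
      rw [output_cons] at hy
      -- One transition together with the delivery of the letter it reads, which the outer induction
      -- provides.
      have key (hv : v = none ∨ v = some x) :
          ∃ i' l', D.Reach ⟨(q₀, p) :: l, .down i f (some x), R⟩
            ⟨l', .up i' f, (q', pending (some x) v) :: R⟩ ∧ D.Delivers i' l' (input ρ) ∧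
            l'.length = n := by
        have hs := ZStep.fire (D := D) l i f (some x) R q₀ p u v q' ht hv
        cases u with
        | none => exact ⟨i, l, .single hs, hl, hn⟩
        | some a =>
          obtain ⟨i', l', hr, hd, hl'⟩ := ih hl ((q', pending (some x) v) :: R) hn
          exact ⟨i', l', .head hs hr, hd, hl'⟩
      cases v with
      | none =>
        obtain ⟨i', l', hr, hd, hl'⟩ := key (.inl rfl)
        obtain ⟨i'', l'', hr', hd', hl''⟩ := ihρ q' none l' ⟨qf, hqf, hρ⟩ hy hd hl'
        exact ⟨i'', l'', hr.trans (.head (.resume ..) hr'), hd', hl''⟩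
      | some b =>
        obtain ⟨rfl, hy'⟩ := List.cons.inj hy
        obtain ⟨i', l', hr, hd, hl'⟩ := key (.inr rfl)
        exact ⟨i', (q', none) :: l', hr.tail (.pass ..), ⟨ρ, ⟨qf, hqf, hρ⟩, hy', hd⟩, by simp [hl']⟩

/-- A demand for the end of the word makes the nearest cell complete its run, which can only write
`ε`; then the demand moves one cell to the left. -/
theorem Delivers.reach_accepted {i : σ} {l : List (Cell Γ Q)} (h : D.Delivers i l []) (f : τ)
    (R : List (Cell Γ Q)) :
    ∃ z, D.Reach ⟨l, .down i f none, R⟩ z ∧ z.control = .accepted := by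
  generalize hn : l.length = n
  induction n generalizing i l R with
  | zero =>
    obtain rfl := List.length_eq_zero_iff.1 hn
    exact ⟨_, .single (.accept i f R h), rfl⟩
  | succ n ih =>
    obtain ⟨⟨q, p⟩, l, rfl⟩ := List.exists_cons_of_length_eq_add_one hn
    obtain ⟨ρ, hq, hy, hl⟩ := h
    replace hn : l.length = n := Nat.succ.inj hn
    induction ρ generalizing i q p l with
    | nil =>
      obtain ⟨qf, hqf, rfl⟩ := hq
      obtain ⟨z, hz, hz'⟩ := ih hl ((q, p) :: R) hn
      exact ⟨z, .head (.finish l i f q p R hqf) hz, hz'⟩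
    | cons t ρ ihρ =>
      obtain ⟨q₀, ⟨u, v⟩, q'⟩ := t
      obtain ⟨qf, hqf, ht, rfl, hρ⟩ := hq
      rw [input_cons] at hl
      rw [output_cons] at hy
      obtain ⟨hv, hy⟩ := List.append_eq_nil_iff.1 hy
      obtain rfl : v = none := by simpa using hv
      have hs := ZStep.fire (D := D) l i f none R q₀ p u none q' ht (.inl rfl)
      have key : ∃ i' l', D.Reach ⟨(q₀, p) :: l, .down i f none, R⟩
          ⟨l', .up i' f, (q', some none) :: R⟩ ∧ D.Delivers i' l' (input ρ) ∧
          l'.length = n := by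
        cases u with
        | none => exact ⟨i, l, .single hs, hl, hn⟩
        | some a =>
          obtain ⟨i', l', hr, hd, hl'⟩ := Delivers.reach_up D hl f ((q', some none) :: R)
          exact ⟨i', l', .head hs hr, hd, hl'.trans hn⟩
      obtain ⟨i', l', hr, hd, hl'⟩ := key
      obtain ⟨z, hz, hz'⟩ := ihρ q' none l' ⟨qf, hqf, hρ⟩ hy hd hl'
      exact ⟨z, hr.trans (.head (.resume ..) hz), hz'⟩

theorem Delivers.exists_zRun_up {i : σ} {f : τ} {l : List (Cell Γ Q)} {y : List Γ}
    (h : D.Delivers i l y) (hf : D.target.evalFrom f y ∈ D.target.accept) :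
    ∃ z, D.Reach ⟨l, .up i f, []⟩ z ∧ z.control = .accepted := by
  induction y generalizing i f l with
  | nil =>
    obtain ⟨z, hz, hz'⟩ := h.reach_accepted D f []
    exact ⟨z, .head (.close l i f hf) hz, hz'⟩
  | cons x y ih =>
    obtain ⟨i', l', hr, hd, -⟩ := h.reach_up D (D.target.step f x) []
    obtain ⟨z, hz, hz'⟩ := ih hd hf
    exact ⟨z, .head (.guess l i f x) (hr.trans hz), hz'⟩

/-! #### Uniqueness of accepting computations

A computation is determined by the list of transitions used at each cell, where `none` marks the
`finish` step, and the word guessed on the right, where `none` marks its end. -/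

/-- The computation `r` from a configuration uses the given transitions at the cells on the left and
on the right, and guesses the given word on the right. -/
inductive Follows : Zipper Γ Q σ τ → List (List (Option (Q × (Option Γ × Option Γ) × Q))) →
    List (List (Option (Q × (Option Γ × Option Γ) × Q))) → List (Option Γ) →
    List (Zipper Γ Q σ τ) → Prop
  | start {l q ρ t s k g r}
      (h : Follows ⟨(q, none) :: l, .up D.source.start D.target.start, ρ⟩ (t :: s) k g r) :
      Follows ⟨l, .start, (q, none) :: ρ⟩ s (t :: k) g
        (⟨(q, none) :: l, .up D.source.start D.target.start, ρ⟩ :: r)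
  | pass {l i f q ρ t s k g r} (h : Follows ⟨(q, none) :: l, .up i f, ρ⟩ (t :: s) k g r) :
      Follows ⟨l, .up i f, (q, none) :: ρ⟩ s (t :: k) g (⟨(q, none) :: l, .up i f, ρ⟩ :: r)
  | resume {l i f q d ρ t s k g r} (h : Follows ⟨(q, none) :: l, .down i f d, ρ⟩ (t :: s) k g r) :
      Follows ⟨l, .up i f, (q, some d) :: ρ⟩ s (t :: k) g (⟨(q, none) :: l, .down i f d, ρ⟩ :: r)
  | guess {l i f x s k g r} (h : Follows ⟨l, .down i (D.target.step f x) (some x), []⟩ s k g r) :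
      Follows ⟨l, .up i f, []⟩ s k (some x :: g)
        (⟨l, .down i (D.target.step f x) (some x), []⟩ :: r)
  | close {l i f s k g r} (h : Follows ⟨l, .down i f none, []⟩ s k g r) :
      Follows ⟨l, .up i f, []⟩ s k (none :: g) (⟨l, .down i f none, []⟩ :: r)
  | fire {l i f d ρ q p u v q' s t k g r}
      (h : Follows ⟨l, .afterRead i f u, (q', pending d v) :: ρ⟩ s (t :: k) g r) :
      Follows ⟨(q, p) :: l, .down i f d, ρ⟩ ((some (q, (u, v), q') :: t) :: s) k g
        (⟨l, .afterRead i f u, (q', pending d v) :: ρ⟩ :: r)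
  | finish {l i f q p ρ s t k g r} (h : Follows ⟨l, .down i f none, (q, p) :: ρ⟩ s (t :: k) g r) :
      Follows ⟨(q, p) :: l, .down i f none, ρ⟩ ((none :: t) :: s) k g
        (⟨l, .down i f none, (q, p) :: ρ⟩ :: r)
  | supply {i f x ρ s k g r} (h : Follows ⟨[], .up (D.source.step i x) f, ρ⟩ s k g r) :
      Follows ⟨[], .down i f (some x), ρ⟩ s k g (⟨[], .up (D.source.step i x) f, ρ⟩ :: r)
  | accept {i f ρ s k g r} (h : Follows ⟨[], .accepted, ρ⟩ s k g r) :
      Follows ⟨[], .down i f none, ρ⟩ s k g (⟨[], .accepted, ρ⟩ :: r)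
  | accepted {l ρ s k g} : Follows ⟨l, .accepted, ρ⟩ s k g []

/-- The only choices of the simulation are made in `fire` against `finish` and in `guess` against
`close`; the first unused entry of `s` or of `g` settles them. -/
theorem Follows.unique {z : Zipper Γ Q σ τ}
    {s k : List (List (Option (Q × (Option Γ × Option Γ) × Q)))} {g : List (Option Γ)}
    {r r' : List (Zipper Γ Q σ τ)} (h : D.Follows z s k g r) (h' : D.Follows z s k g r') :
    r = r' := by
  induction h generalizing r' <;> cases h' <;>
    first | rfl | (congr 1; apply_assumption; assumption)

/-- The transitions `k` at the cells on the right, and the guesses `g`, are consistent with the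
delivery of the word `z` from the left. -/
def Consumes (f : τ) : List (Cell Γ Q) → List (List (Option (Q × (Option Γ × Option Γ) × Q))) →
    List (Option Γ) → List Γ → Prop
  | [], k, g, z => k = [] ∧ g = z.map some ++ [none] ∧ D.target.evalFrom f z ∈ D.target.accept
  | _ :: _, [], _, _ => False
  | c :: R, t :: k, g, z => ∃ ρ, t = ρ.map some ++ [none] ∧ D.Terminates c.1 ρ ∧ input ρ = z ∧
      match c.2 with
      | none => Consumes f R k g (output ρ)
      | some none => output ρ = [] ∧ k = R.map (fun _ => []) ∧ g = []
      | some (some x) => ∃ y, output ρ = x :: y ∧ Consumes f R k g y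

/-- The transitions `s` at the cells on the left are consistent with the delivery of the word `y`
to the right. -/
def Produces (i : σ) : List (Cell Γ Q) → List (List (Option (Q × (Option Γ × Option Γ) × Q))) →
    List Γ → Prop
  | [], s, y => s = [] ∧ D.source.evalFrom i y ∈ D.source.accept
  | _ :: _, [], _ => False
  | c :: l, t :: s, y => ∃ ρ, t = ρ.map some ++ [none] ∧ D.Terminates c.1 ρ ∧ output ρ = y ∧
      Produces i l s (input ρ)

/-- Consistency of the given transitions and guesses with the current configuration. -/
def Consistent : Zipper Γ Q σ τ → List (List (Option (Q × (Option Γ × Option Γ) × Q))) →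
    List (List (Option (Q × (Option Γ × Option Γ) × Q))) → List (Option Γ) → Prop
  | ⟨l, .start, R⟩, s, k, g =>
      ∃ y, D.Produces D.source.start l s y ∧ D.Consumes D.target.start R k g y
  | ⟨l, .up i f, R⟩, s, k, g => ∃ y, D.Produces i l s y ∧ D.Consumes f R k g y
  | ⟨l, .down i f (some x), R⟩, s, k, g => ∃ y, D.Produces i l s (x :: y) ∧ D.Consumes f R k g y
  | ⟨l, .down i _ none, R⟩, s, k, g =>
      D.Produces i l s [] ∧ k = R.map (fun _ => []) ∧ g = []
  | ⟨l, .accepted, R⟩, s, k, g =>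
      s = l.map (fun _ => []) ∧ k = R.map (fun _ => []) ∧ g = []

theorem Consumes.exists_cons {f : τ} {c : Cell Γ Q} {R : List (Cell Γ Q)}
    {k : List (List (Option (Q × (Option Γ × Option Γ) × Q)))} {g : List (Option Γ)} {z : List Γ}
    (h : D.Consumes f (c :: R) k g z) : ∃ t k', k = t :: k' := by
  cases k with
  | nil => exact h.elim
  | cons t k => exact ⟨t, k, rfl⟩

theorem Produces.exists_cons {i : σ} {c : Cell Γ Q} {l : List (Cell Γ Q)}
    {s : List (List (Option (Q × (Option Γ × Option Γ) × Q)))} {y : List Γ}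
    (h : D.Produces i (c :: l) s y) : ∃ t s', s = t :: s' := by
  cases s with
  | nil => exact h.elim
  | cons t s => exact ⟨t, s, rfl⟩

theorem Terminates.cons {q q' : Q} {u v : Option Γ}
    {ρ : List (Q × (Option Γ × Option Γ) × Q)} (ht : (q, (u, v), q') ∈ D.trans)
    (h : D.Terminates q' ρ) : D.Terminates q ((q, (u, v), q') :: ρ) := by
  obtain ⟨qf, hqf, hρ⟩ := h
  exact ⟨qf, hqf, ht, rfl, hρ⟩

/-- Undoing a `fire` step puts its transition in front of the remaining run of the cell: `u` is
added to the word expected from the left, `v` to the word delivered to the right. -/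
theorem consistent_of_fire {l : List (Cell Γ Q)} {i : σ} {f : τ} {d : Option Γ}
    {R : List (Cell Γ Q)} {q q' : Q} {p : Option (Option Γ)} {u v : Option Γ}
    (ht : (q, (u, v), q') ∈ D.trans) (hv : v = none ∨ v = d)
    {s k : List (List (Option (Q × (Option Γ × Option Γ) × Q)))} {g : List (Option Γ)}
    {t : List (Option (Q × (Option Γ × Option Γ) × Q))}
    (h : D.Consistent ⟨l, .afterRead i f u, (q', pending d v) :: R⟩ s (t :: k) g) :
    D.Consistent ⟨(q, p) :: l, .down i f d, R⟩ ((some (q, (u, v), q') :: t) :: s) k g := by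
  -- This covers both values of `afterRead`: for `u = none` the control goes up, otherwise it
  -- demands the letter `u`.
  have key : ∃ y, D.Produces i l s (u.toList ++ y) ∧
      D.Consumes f ((q', pending d v) :: R) (t :: k) g y := by
    cases u <;> exact h
  obtain ⟨y, hl, ρ, rfl, hρ, rfl, h⟩ := key
  have hl' (w : List Γ) (hw : v.toList ++ output ρ = w) :
      D.Produces i ((q, p) :: l) ((some (q, (u, v), q') :: (ρ.map some ++ [none])) :: s) w :=
    ⟨(q, (u, v), q') :: ρ, rfl, hρ.cons D ht, by rw [output_cons, hw], by rwa [input_cons]⟩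
  cases v with
  | none =>
    cases d with
    | none => exact ⟨hl' _ h.1, h.2⟩
    | some x =>
      obtain ⟨y, hy, h⟩ := h
      exact ⟨y, hl' _ hy, h⟩
  | some b =>
    obtain rfl : some b = d := by simpa using hv
    exact ⟨_, hl' _ rfl, h⟩

/-- The data are collected backwards in time from the accepting configuration, where nothing remains
to be done; `Consistent` is the invariant that survives undoing each kind of step. -/
theorem ZRun.exists_follows {z : Zipper Γ Q σ τ} {r : List (Zipper Γ Q σ τ)} (h : D.ZRun z r) :
    ∃ s k g, D.Follows z s k g r ∧ D.Consistent z s k g := by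
  induction r generalizing z with
  | nil =>
    obtain ⟨l, c, R⟩ := z
    obtain rfl : c = .accepted := h
    exact ⟨_, _, _, .accepted, rfl, rfl, rfl⟩
  | cons z' r ih =>
    obtain ⟨h, hr⟩ := h
    obtain ⟨s, k, g, hf, hc⟩ := ih hr
    cases h with
    | start l q R =>
      obtain ⟨y, hl, h⟩ := hc
      obtain ⟨t, s, rfl⟩ := hl.exists_cons
      obtain ⟨ρ, rfl, hρ, rfl, hl⟩ := hl
      exact ⟨_, _, _, .start hf, _, hl, ρ, rfl, hρ, rfl, h⟩
    | pass l i f q R =>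
      obtain ⟨y, hl, h⟩ := hc
      obtain ⟨t, s, rfl⟩ := hl.exists_cons
      obtain ⟨ρ, rfl, hρ, rfl, hl⟩ := hl
      exact ⟨_, _, _, .pass hf, _, hl, ρ, rfl, hρ, rfl, h⟩
    | resume l i f q d R =>
      cases d with
      | none =>
        obtain ⟨hl, rfl, rfl⟩ := hc
        obtain ⟨t, s, rfl⟩ := hl.exists_cons
        obtain ⟨ρ, rfl, hρ, hy, hl⟩ := hl
        exact ⟨_, _, _, .resume hf, _, hl, ρ, rfl, hρ, rfl, hy, rfl, rfl⟩
      | some x =>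
        obtain ⟨y, hl, h⟩ := hc
        obtain ⟨t, s, rfl⟩ := hl.exists_cons
        obtain ⟨ρ, rfl, hρ, hy, hl⟩ := hl
        exact ⟨_, _, _, .resume hf, _, hl, ρ, rfl, hρ, rfl, y, hy, h⟩
    | guess l i f x =>
      obtain ⟨y, hl, rfl, rfl, h⟩ := hc
      exact ⟨_, _, _, .guess hf, _, hl, rfl, rfl, h⟩
    | close l i f hacc =>
      obtain ⟨hl, rfl, rfl⟩ := hc
      exact ⟨_, _, _, .close hf, _, hl, rfl, rfl, hacc⟩
    | fire l i f d R q p u v q' ht hv =>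
      obtain ⟨t, k, rfl⟩ : ∃ t k', k = t :: k' := by
        cases u <;> obtain ⟨y, hl, h⟩ := hc <;> exact h.exists_cons
      exact ⟨_, _, _, .fire hf, D.consistent_of_fire ht hv hc⟩
    | finish l i f q p R hq =>
      obtain ⟨hl, rfl, rfl⟩ := hc
      exact ⟨_, _, _, .finish hf, ⟨[], rfl, ⟨q, hq, rfl⟩, rfl, hl⟩, rfl, rfl⟩
    | supply i f x R =>
      obtain ⟨y, ⟨rfl, hl⟩, h⟩ := hc
      exact ⟨_, _, _, .supply hf, y, ⟨rfl, hl⟩, h⟩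
    | accept i f R hi =>
      obtain ⟨rfl, rfl, rfl⟩ := hc
      exact ⟨_, _, _, .accept hf, ⟨rfl, hi⟩, rfl, rfl⟩

/-! #### Paths of the graph -/

section Graph

variable [Finite Q] {α : Type*} (st : α → Q)

/-- The rational graph whose transducer with label `a` starts in the state `st a`. -/
def graph : RationalGraph α Γ := fun a => ⟨Q, ‹Finite Q›, st a, D.final, D.trans⟩

/-- The initial contents of the tape. -/
def cells (w : List α) : List (Cell Γ Q) := w.map fun a => (st a, none)

/-- On the initial tape no demand is pending, so what one cell writes is exactly what the next one
reads. These common words are the vertices of the path. -/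
theorem Consumes.exists_path {w : List α}
    {k : List (List (Option (Q × (Option Γ × Option Γ) × Q)))} {g : List (Option Γ)} {z : List Γ}
    (h : D.Consumes D.target.start (cells st w) k g z) :
    ∃ p t, IsPath (D.graph st).edges z p t ∧ p.map (fun e => e.2.1) = w ∧ t ∈ D.target.accepts ∧
      g = t.map some ++ [none] ∧
      List.Forall₂ (fun e m => ∃ ρ, (D.graph st e.2.1).AcceptingRun e.1 e.2.2 ρ ∧
        m = ρ.map some ++ [none]) p k := by
  induction w generalizing k z with
  | nil =>
    obtain ⟨rfl, rfl, h⟩ := h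
    exact ⟨[], z, rfl, rfl, h, rfl, .nil⟩
  | cons a w ih =>
    obtain ⟨t, k, rfl⟩ := h.exists_cons
    obtain ⟨ρ, rfl, hρ, rfl, h⟩ := h
    obtain ⟨p, t, hp, rfl, ht, rfl, hk⟩ := ih h
    have hρ' : (D.graph st a).AcceptingRun (input ρ) (output ρ) ρ := ⟨hρ, rfl, rfl⟩
    exact ⟨(input ρ, a, output ρ) :: p, t, ⟨⟨ρ, hρ'⟩, rfl, hp⟩, rfl, ht, rfl, .cons ⟨ρ, hρ', rfl⟩ hk⟩

theorem Delivers.of_path {i : σ} {l : List (Cell Γ Q)} {s t : List Γ}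
    {p : List (List Γ × α × List Γ)} (hl : D.Delivers i l s)
    (hp : IsPath (D.graph st).edges s p t) :
    D.Delivers i ((cells st (p.map fun e => e.2.1)).reverse ++ l) t := by
  induction p generalizing l s with
  | nil => obtain rfl : s = t := hp; exact hl
  | cons e p ih =>
    obtain ⟨⟨ρ, hρ, hin, hout⟩, rfl, hp⟩ := hp
    have := ih (l := (st e.2.1, none) :: l) ⟨ρ, hρ, hout, (show input ρ = e.1 from hin) ▸ hl⟩ hp
    simpa [cells] using this

omit [Finite Q] in
theorem reach_up_cells (w : List α) (l : List (Cell Γ Q)) (i : σ) (f : τ) :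
    D.Reach ⟨l, .up i f, cells st w⟩ ⟨(cells st w).reverse ++ l, .up i f, []⟩ := by
  induction w generalizing l with
  | nil => exact .refl
  | cons a w ih =>
    refine .head (.pass l i f (st a) _) ?_
    simpa [cells] using ih ((st a, none) :: l)

theorem exists_zRun_of_mem_pathLanguage {w : List α}
    (h : w ∈ pathLanguage (D.graph st).edges D.source.accepts D.target.accepts) :
    ∃ r, D.ZRun ⟨[], .start, cells st w⟩ r := by
  obtain ⟨p, hp, rfl, s, hs, t, ht, hpath⟩ := h
  have hd : D.Delivers D.source.start [] s := hs
  obtain ⟨z, hz, hacc⟩ := (hd.of_path D st hpath).exists_zRun_up D ht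
  obtain ⟨e, p, rfl⟩ := List.exists_cons_of_ne_nil hp
  refine D.exists_zRun_of_reach (.head (.start [] (st e.2.1) _) (.trans ?_ hz)) hacc
  simpa [cells] using D.reach_up_cells st (p.map fun e => e.2.1) [(st e.2.1, none)] _ _

theorem ZRun.exists_path {w : List α} {r : List (Zipper Γ Q σ τ)}
    (h : D.ZRun ⟨[], .start, cells st w⟩ r) :
    ∃ k p s t, s ∈ D.source.accepts ∧ t ∈ D.target.accepts ∧
      IsPath (D.graph st).edges s p t ∧ p.map (fun e => e.2.1) = w ∧
      List.Forall₂ (fun e m => ∃ ρ, (D.graph st e.2.1).AcceptingRun e.1 e.2.2 ρ ∧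
        m = ρ.map some ++ [none]) p k ∧
      D.Follows ⟨[], .start, cells st w⟩ [] k (t.map some ++ [none]) r := by
  obtain ⟨s, k, g, hf, y, ⟨rfl, hy⟩, hc⟩ := h.exists_follows
  obtain ⟨p, t, hp, hw, ht, rfl, hk⟩ := hc.exists_path D st
  exact ⟨k, p, y, t, hy, ht, hp, hw, hk, hf⟩

theorem mem_pathLanguage_of_zRun {w : List α} (hw : w ≠ []) {r : List (Zipper Γ Q σ τ)}
    (h : D.ZRun ⟨[], .start, cells st w⟩ r) :
    w ∈ pathLanguage (D.graph st).edges D.source.accepts D.target.accepts := by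
  obtain ⟨k, p, s, t, hs, ht, hp, rfl, -, -⟩ := h.exists_path D st
  exact ⟨p, by simpa using hw, rfl, s, hs, t, ht, hp⟩

/-- Two computations have the same path because the graph is unambiguous, hence the same guessed
word; their transitions agree because each transducer is unambiguous; `Follows.unique` then applies.
-/
theorem zRun_unique (hT : ∀ a, (D.graph st a).Unambiguous)
    (hG : GraphUnambiguous (D.graph st).edges D.source.accepts D.target.accepts)
    {w : List α} (hw : w ≠ []) {r r' : List (Zipper Γ Q σ τ)}
    (h : D.ZRun ⟨[], .start, cells st w⟩ r) (h' : D.ZRun ⟨[], .start, cells st w⟩ r') :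
    r = r' := by
  have hmem := D.mem_pathLanguage_of_zRun st hw h
  obtain ⟨k, p, s, t, hs, ht, hp, hpw, hk, hf⟩ := h.exists_path D st
  obtain ⟨k', p', s', t', hs', ht', hp', hpw', hk', hf'⟩ := h'.exists_path D st
  have hne : p ≠ [] := by rintro rfl; exact hw hpw.symm
  have hne' : p' ≠ [] := by rintro rfl; exact hw hpw'.symm
  obtain rfl : p = p' := (hG w hmem).unique ⟨hne, hpw, s, hs, t, ht, hp⟩
    ⟨hne', hpw', s', hs', t', ht', hp'⟩
  obtain rfl := hp.source_unique hne hp'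
  obtain rfl := hp.target_unique hp'
  obtain rfl : k = k' := by
    clear hf hf' hpw hpw' hne hne' hp hp'
    induction hk generalizing k' with
    | nil => cases hk'; rfl
    | cons he _ ih =>
      cases hk' with
      | cons he' hk' =>
        obtain ⟨ρ, hρ, rfl⟩ := he
        obtain ⟨ρ', hρ', rfl⟩ := he'
        rw [ih _ hk', (hT _ _ _ ⟨ρ, hρ⟩).unique hρ hρ']
  exact hf.unique D hf'

end Graph

/-! #### The machine -/

/-- The instructions of the machine. -/
inductive Instr : Control Γ σ τ → Option (Cell Γ Q) →
    Control Γ σ τ × Option (Cell Γ Q) × Move → Prop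
  | start (q) : Instr .start (some (q, none))
      (.up D.source.start D.target.start, some (q, none), .right)
  | pass (i f q) : Instr (.up i f) (some (q, none)) (.up i f, some (q, none), .right)
  | resume (i f q r) : Instr (.up i f) (some (q, some r)) (.down i f r, some (q, none), .stay)
  | guess (i f x) : Instr (.up i f) none (.down i (D.target.step f x) (some x), none, .left)
  | close (i f) (hf : f ∈ D.target.accept) : Instr (.up i f) none (.down i f none, none, .left)
  | fire (i f r q p u v q') (ht : (q, (u, v), q') ∈ D.trans) (hv : v = none ∨ v = r) :
      Instr (.down i f r) (some (q, p))
        (.afterRead i f u, some (q', pending r v), if u = none then .stay else .left)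
  | finish (i f q p) (hq : q ∈ D.final) :
      Instr (.down i f none) (some (q, p)) (.down i f none, some (q, p), .left)
  | supply (i f x) : Instr (.down i f (some x)) none (.up (D.source.step i x) f, none, .right)
  | accept (i f) (hi : i ∈ D.source.accept) :
      Instr (.down i f none) none (.accepted, none, .stay)

/-- The tape holding `l` in reverse followed by `R`. -/
def tape (l R : List (Cell Γ Q)) (i : ℤ) : Option (Cell Γ Q) :=
  if 0 ≤ i then (l.reverse ++ R)[i.toNat]? else none

/-- Shifting the focus of a zipper leaves the tape unchanged. -/
theorem tape_cons (c : Cell Γ Q) (l R : List (Cell Γ Q)) : tape (c :: l) R = tape l (c :: R) := by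
  ext1 i
  simp [tape]

theorem tape_length (l R : List (Cell Γ Q)) : tape l R l.length = R.head? := by
  cases R <;> simp [tape]

theorem tape_nil_neg (R : List (Cell Γ Q)) : tape [] R (-1) = none := by
  simp [tape]

theorem update_tape (c c' : Cell Γ Q) (l R : List (Cell Γ Q)) :
    Function.update (tape l (c :: R)) l.length (some c') = tape l (c' :: R) := by
  ext1 i
  rcases eq_or_ne i l.length with rfl | h
  · simp [tape]
  · rw [Function.update_of_ne h]
    unfold tape
    split_ifs with hi
    · obtain ⟨m, rfl⟩ := Int.eq_ofNat_of_zero_le hi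
      have hm : m ≠ l.length := by exact_mod_cast h
      rcases lt_or_gt_of_ne hm with hm | hm
      · simp [List.getElem?_append, hm]
      · obtain ⟨d, rfl⟩ := Nat.exists_eq_add_of_lt hm
        rw [Int.toNat_natCast, List.getElem?_append_right (by simp; omega),
          List.getElem?_append_right (by simp; omega),
          show l.length + d + 1 - l.reverse.length = d + 1 by simp; omega,
          List.getElem?_cons_succ, List.getElem?_cons_succ]
    · rfl

/-- The head position relative to the number of cells on the left. -/
def Control.offset : Control Γ σ τ → ℤ
  | .start | .up _ _ => 0
  | .down _ _ _ | .accepted => -1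

/-- The symbol read in a zipper. -/
def Zipper.symbol (z : Zipper Γ Q σ τ) : Option (Cell Γ Q) :=
  tape z.left z.right (z.left.length + z.control.offset)

theorem symbol_of_offset_eq_zero {l R : List (Cell Γ Q)} {s : Control Γ σ τ} (hs : s.offset = 0) :
    Zipper.symbol ⟨l, s, R⟩ = R.head? := by
  simp [Zipper.symbol, hs, tape_length]

theorem symbol_cons_down {c : Cell Γ Q} {l R : List (Cell Γ Q)} {i : σ} {f : τ} {r : Option Γ} :
    Zipper.symbol ⟨c :: l, .down i f r, R⟩ = some c := by
  simp [Zipper.symbol, Control.offset, tape_cons, tape_length]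

theorem symbol_nil_down {R : List (Cell Γ Q)} {i : σ} {f : τ} {r : Option Γ} :
    Zipper.symbol ⟨[], .down i f r, R⟩ = none := by
  simp [Zipper.symbol, Control.offset, tape_nil_neg]

/-- The zipper `z'` is the result of writing, moving and changing state as told by `t`. -/
def Executes (z z' : Zipper Γ Q σ τ) (t : Control Γ σ τ × Option (Cell Γ Q) × Move) : Prop :=
  z'.control = t.1 ∧
    z'.left.length + z'.control.offset = z.left.length + z.control.offset + t.2.2.shift ∧
    tape z'.left z'.right =
      Function.update (tape z.left z.right) (z.left.length + z.control.offset) t.2.1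

theorem executes_right {l R : List (Cell Γ Q)} {c : Cell Γ Q} {s s' : Control Γ σ τ}
    (hs : s.offset = 0) (hs' : s'.offset = 0) :
    Executes ⟨l, s, c :: R⟩ ⟨c :: l, s', R⟩ (s', some c, .right) := by
  simp [Executes, hs, hs', Move.shift, tape_cons, update_tape]

theorem executes_resume {l R : List (Cell Γ Q)} {c c' : Cell Γ Q} {i : σ} {f : τ} {r : Option Γ} :
    Executes ⟨l, .up i f, c :: R⟩ ⟨c' :: l, .down i f r, R⟩ (.down i f r, some c', .stay) := by
  simp [Executes, Control.offset, Move.shift, tape_cons, update_tape]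

theorem executes_guess {l : List (Cell Γ Q)} {i : σ} {f f' : τ} {r : Option Γ} :
    Executes ⟨l, .up i f, []⟩ ⟨l, .down i f' r, []⟩ (.down i f' r, none, .left) := by
  simp [Executes, Control.offset, Move.shift, tape_length]

theorem executes_fire {l R : List (Cell Γ Q)} {c c' : Cell Γ Q} {i : σ} {f : τ} {r : Option Γ}
    {u : Option Γ} :
    Executes ⟨c :: l, .down i f r, R⟩ ⟨l, .afterRead i f u, c' :: R⟩
      (.afterRead i f u, some c', if u = none then .stay else .left) := by
  cases u <;>
    simp [Executes, Control.offset, Control.afterRead, Move.shift, tape_cons, update_tape]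

theorem executes_finish {l R : List (Cell Γ Q)} {c : Cell Γ Q} {i : σ} {f : τ} {r r' : Option Γ} :
    Executes ⟨c :: l, .down i f r, R⟩ ⟨l, .down i f r', c :: R⟩
      (.down i f r', some c, .left) := by
  simp [Executes, Control.offset, Move.shift, tape_cons, update_tape]

theorem executes_supply {R : List (Cell Γ Q)} {i i' : σ} {f : τ} {r : Option Γ} :
    Executes ⟨[], .down i f r, R⟩ ⟨[], .up i' f, R⟩ (.up i' f, none, .right) := by
  simp [Executes, Control.offset, Move.shift, tape_nil_neg]

theorem executes_accept {R : List (Cell Γ Q)} {i : σ} {f : τ} {r : Option Γ} :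
    Executes ⟨[], .down i f r, R⟩ ⟨[], .accepted, R⟩ (.accepted, none, .stay) := by
  simp [Executes, Control.offset, Move.shift, tape_nil_neg]

theorem ZStep.exists_instr {z z' : Zipper Γ Q σ τ} (h : D.ZStep z z') :
    ∃ t, D.Instr z.control z.symbol t ∧ Executes z z' t := by
  cases h with
  | start l q R =>
    refine ⟨_, ?_, executes_right rfl rfl⟩
    rw [symbol_of_offset_eq_zero rfl]
    exact .start q
  | pass l i f q R =>
    refine ⟨_, ?_, executes_right rfl rfl⟩
    rw [symbol_of_offset_eq_zero rfl]
    exact .pass i f q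
  | resume l i f q r R =>
    refine ⟨_, ?_, executes_resume⟩
    rw [symbol_of_offset_eq_zero rfl]
    exact .resume i f q r
  | guess l i f x =>
    refine ⟨_, ?_, executes_guess⟩
    rw [symbol_of_offset_eq_zero rfl]
    exact .guess i f x
  | close l i f hf =>
    refine ⟨_, ?_, executes_guess⟩
    rw [symbol_of_offset_eq_zero rfl]
    exact .close i f hf
  | fire l i f r R q p u v q' ht hv =>
    refine ⟨_, ?_, executes_fire⟩
    rw [symbol_cons_down]
    exact .fire i f r q p u v q' ht hv
  | finish l i f q p R hq =>
    refine ⟨_, ?_, executes_finish⟩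
    rw [symbol_cons_down]
    exact .finish i f q p hq
  | supply i f x R =>
    refine ⟨_, ?_, executes_supply⟩
    rw [symbol_nil_down]
    exact .supply i f x
  | accept i f R hi =>
    refine ⟨_, ?_, executes_accept⟩
    rw [symbol_nil_down]
    exact .accept i f hi

/-- Together with `ZStep.exists_instr` this makes zippers and machine configurations bisimilar.
Machine computations lift to zippers, so uniqueness transfers without injectivity of `config`. -/
theorem Instr.exists_zStep {z : Zipper Γ Q σ τ} {t : Control Γ σ τ × Option (Cell Γ Q) × Move}
    (h : D.Instr z.control z.symbol t) : ∃ z', D.ZStep z z' ∧ Executes z z' t := by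
  obtain ⟨l, s, R⟩ := z
  cases s with
  | start =>
    rw [symbol_of_offset_eq_zero rfl] at h
    rcases R with _ | ⟨c, R⟩
    · cases h
    cases h with
    | start q => exact ⟨_, .start l q R, executes_right rfl rfl⟩
  | accepted => cases h
  | up i f =>
    rw [symbol_of_offset_eq_zero rfl] at h
    rcases R with _ | ⟨c, R⟩
    · cases h with
      | guess _ _ x => exact ⟨_, .guess l i f x, executes_guess⟩
      | close _ _ hf => exact ⟨_, .close l i f hf, executes_guess⟩
    · cases h with
      | pass _ _ q => exact ⟨_, .pass l i f q R, executes_right rfl rfl⟩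
      | resume _ _ q r => exact ⟨_, .resume l i f q r R, executes_resume⟩
  | down i f r =>
    rcases l with _ | ⟨c, l⟩
    · rw [symbol_nil_down] at h
      cases h with
      | supply _ _ x => exact ⟨_, .supply i f x R, executes_supply⟩
      | accept _ _ hi => exact ⟨_, .accept i f R hi, executes_accept⟩
    · rw [symbol_cons_down] at h
      cases h with
      | fire _ _ _ q p u v q' ht hv =>
        exact ⟨_, .fire l i f r R q p u v q' ht hv, executes_fire⟩
      | finish _ _ q p hq => exact ⟨_, .finish l i f q p R hq, executes_finish⟩

theorem ZStep.length_eq {z z' : Zipper Γ Q σ τ} (h : D.ZStep z z') :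
    z'.left.length + z'.right.length = z.left.length + z.right.length := by
  cases h <;> simp <;> omega

section Machine

variable [Finite Γ] [Finite Q] [Finite σ] [Finite τ] {α : Type*} (st : α → Q)
  (hst : Function.Injective st)

/-- The machine simulating the graph. -/
def machine : Machine α where
  Q := Control Γ σ τ
  finQ := inferInstance
  Γ := Option (Cell Γ Q)
  finΓ := inferInstance
  input := fun a => some (st a, none)
  input_injective := fun a b h => hst (by simpa using h)
  blank := none
  blank_notMem := by simp
  start := .start
  accept := {.accepted}
  trans := fun s c => {t | D.Instr s c t}
  accept_halts := by
    rintro _ rfl c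
    ext t
    simp only [Set.mem_ofPred_eq, Set.mem_empty_iff_false, iff_false]
    rintro ⟨⟩

/-- The machine configuration represented by a zipper. -/
def config (z : Zipper Γ Q σ τ) : (D.machine st hst).Config :=
  ⟨z.control, z.left.length + z.control.offset, tape z.left z.right⟩

theorem config_initial (w : List α) :
    D.config st hst ⟨[], .start, cells st w⟩ = (D.machine st hst).initialConfig w := by
  have : tape [] (cells (Γ := Γ) st w) = ((D.machine st hst).initialConfig w).tape := by
    ext1 i
    simp only [tape, Machine.initialConfig, cells, machine]
    split_ifs
    · simp [List.getD_eq_getElem?_getD]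
      cases w[i.toNat]? <;> rfl
    · rfl
  simp only [config, this]
  rfl

theorem Executes.config_eq {z z' : Zipper Γ Q σ τ}
    {t : Control Γ σ τ × Option (Cell Γ Q) × Move} (h : Executes z z' t) :
    D.config st hst z' = ⟨t.1, (D.config st hst z).head + t.2.2.shift,
      Function.update (D.config st hst z).tape (D.config st hst z).head t.2.1⟩ := by
  obtain ⟨h₁, h₂, h₃⟩ := h
  simp only [config, h₂, h₃]
  rw [h₁]
  rfl

theorem step_config {z z' : Zipper Γ Q σ τ} (h : D.ZStep z z') :
    (D.machine st hst).Step (D.config st hst z) (D.config st hst z') := by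
  obtain ⟨t, ht, he⟩ := h.exists_instr
  exact ⟨t, ht, he.config_eq D st hst⟩

theorem exists_zStep {z : Zipper Γ Q σ τ} {c : (D.machine st hst).Config}
    (h : (D.machine st hst).Step (D.config st hst z) c) :
    ∃ z', D.ZStep z z' ∧ c = D.config st hst z' := by
  obtain ⟨t, ht, rfl⟩ := h
  obtain ⟨z', hz, he⟩ := Instr.exists_zStep D ht
  exact ⟨z', hz, (he.config_eq D st hst).symm⟩

theorem runFrom_map_config {z : Zipper Γ Q σ τ} {r : List (Zipper Γ Q σ τ)} (h : D.ZRun z r) :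
    (D.machine st hst).RunFrom (D.config st hst z) (r.map (D.config st hst)) := by
  induction r generalizing z with
  | nil => exact h
  | cons z' r ih => exact ⟨D.step_config st hst h.1, ih h.2⟩

theorem exists_zRun {z : Zipper Γ Q σ τ} {r : List (D.machine st hst).Config}
    (h : (D.machine st hst).RunFrom (D.config st hst z) r) :
    ∃ r', D.ZRun z r' ∧ r = r'.map (D.config st hst) := by
  induction r generalizing z with
  | nil => exact ⟨[], h, rfl⟩
  | cons c r ih =>
    obtain ⟨z', hz, rfl⟩ := D.exists_zStep st hst h.1
    obtain ⟨r', hr, rfl⟩ := ih h.2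
    exact ⟨z' :: r', ⟨hz, hr⟩, rfl⟩

/-- The number of cells is invariant and the offset is `0` or `-1`, so the head stays between `-1`
and `|w|`. -/
theorem machine_linearSpace : (D.machine st hst).LinearSpace := by
  refine ⟨1, fun w c hc => ?_⟩
  obtain ⟨z, hz, rfl⟩ : ∃ z : Zipper Γ Q σ τ, z.left.length + z.right.length = w.length ∧
      c = D.config st hst z := by
    induction hc with
    | refl => exact ⟨_, by simp [cells], (D.config_initial st hst w).symm⟩
    | tail _ h ih =>
      obtain ⟨z, hz, rfl⟩ := ih
      obtain ⟨z', hz', rfl⟩ := D.exists_zStep st hst h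
      exact ⟨z', (hz'.length_eq D).trans hz, rfl⟩
  have : z.control.offset = 0 ∨ z.control.offset = -1 := by
    cases z.control <;> simp [Control.offset]
  simp only [config, abs_le]
  omega

theorem machine_nil_notMem : [] ∉ (D.machine st hst).language := by
  rw [Machine.mem_language_iff, ← config_initial]
  rintro ⟨r, hr⟩
  obtain ⟨r', hr', rfl⟩ := D.exists_zRun st hst hr
  cases r' with
  | nil => cases hr'
  | cons z r' => cases hr'.1

theorem machine_language : (D.machine st hst).language =
    pathLanguage (D.graph st).edges D.source.accepts D.target.accepts := by
  ext w
  rcases eq_or_ne w [] with rfl | hw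
  · refine iff_of_false (D.machine_nil_notMem st hst) ?_
    rintro ⟨p, hp, h, -⟩
    exact hp (List.map_eq_nil_iff.1 h)
  · rw [Machine.mem_language_iff, ← config_initial]
    constructor
    · rintro ⟨r, hr⟩
      obtain ⟨r', hr', rfl⟩ := D.exists_zRun st hst hr
      exact D.mem_pathLanguage_of_zRun st hw hr'
    · intro h
      obtain ⟨r, hr⟩ := D.exists_zRun_of_mem_pathLanguage st h
      exact ⟨_, D.runFrom_map_config st hst hr⟩

theorem machine_unambiguous (hT : ∀ a, (D.graph st a).Unambiguous)
    (hG : GraphUnambiguous (D.graph st).edges D.source.accepts D.target.accepts) :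
    (D.machine st hst).Unambiguous := by
  rw [Machine.unambiguous_iff]
  intro w r r' h h'
  have hw : w ≠ [] := by
    rintro rfl
    exact D.machine_nil_notMem st hst ((Machine.mem_language_iff _ _).2 ⟨r, h⟩)
  rw [← config_initial] at h h'
  obtain ⟨s, hs, rfl⟩ := D.exists_zRun st hst h
  obtain ⟨s', hs', rfl⟩ := D.exists_zRun st hst h'
  rw [D.zRun_unique st hT hG hw hs hs']

end Machine

end Cascade

/-! #### Sharing the states of the transducers -/

section Uniform

variable {α : Type*} {Γ : Type}

/-- Every edge leaving `φ s` is the image of an edge leaving `s`, so paths lift step by step; `φ`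
need not be injective. -/
theorem isPath_image_iff {V V' A : Type*} {E : Set (V × A × V)} {E' : Set (V' × A × V')}
    {φ : V → V'}
    (hE : ∀ s a y, (φ s, a, y) ∈ E' ↔ ∃ t, y = φ t ∧ (s, a, t) ∈ E) {s : V} {y : V'}
    {r : List (V' × A × V')} :
    IsPath E' (φ s) r y ↔ ∃ r' t, r = r'.map (fun e => (φ e.1, e.2.1, φ e.2.2)) ∧ y = φ t ∧
      IsPath E s r' t := by
  induction r generalizing s with
  | nil =>
    constructor
    · rintro rfl
      exact ⟨[], s, rfl, rfl, rfl⟩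
    · rintro ⟨r', t, h, rfl, h'⟩
      obtain rfl := List.map_eq_nil_iff.1 h.symm
      exact congrArg φ h'
  | cons e r ih =>
    obtain ⟨x, a, z⟩ := e
    constructor
    · rintro ⟨he, rfl, h⟩
      obtain ⟨u, rfl, hu⟩ := (hE s a z).1 he
      obtain ⟨r', t, rfl, rfl, h'⟩ := ih.1 h
      exact ⟨(s, a, u) :: r', t, rfl, rfl, hu, rfl, h'⟩
    · rintro ⟨_ | ⟨⟨s', a', u⟩, r'⟩, t, h, rfl, h'⟩
      · cases h
      · obtain ⟨hu, rfl, h'⟩ := h'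
        cases h
        exact ⟨(hE _ _ _).2 ⟨u, rfl, hu⟩, rfl, ih.2 ⟨r', t, rfl, rfl, h'⟩⟩

theorem exists_cascade [Finite α] (G : RationalGraph α Γ) :
    ∃ (Q : Type) (_ : Finite Q) (st : α → Q) (final : Set Q)
      (trans : Set (Q × (Option Γ × Option Γ) × Q)), Function.Injective st ∧
      ∀ (σ τ : Type) (A : DFA Γ σ) (B : DFA Γ τ),
        (Cascade.mk final trans A B |>.graph st).edges = G.edges ∧
        ((∀ a, (G a).Unambiguous) → ∀ a, (Cascade.mk final trans A B |>.graph st a).Unambiguous) := by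
  -- Indexing by `Fin N` keeps the disjoint union of the state sets in `Type`, whatever the universe
  -- of `α`.
  obtain ⟨N, ⟨e⟩⟩ := Finite.exists_equiv_fin α
  let H (b : Fin N) : Transducer Γ := G (e.symm b)
  have (b : Fin N) : Finite (H b).Q := (H b).finQ
  let Q : Type := Σ b, (H b).Q
  let final : Set Q := {q | q.2 ∈ (H q.1).final}
  let trans : Set (Q × (Option Γ × Option Γ) × Q) :=
    {t | ∃ b x l y, (x, l, y) ∈ (H b).trans ∧ t = (⟨b, x⟩, l, ⟨b, y⟩)}
  let T (b : Fin N) : Transducer Γ := ⟨Q, inferInstance, ⟨b, (H b).start⟩, final, trans⟩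
  have key (b x y r) : (T b).AcceptingRun x y r ↔ ∃ r', (H b).AcceptingRun x y r' ∧
      r = r'.map fun t => (⟨b, t.1⟩, t.2.1, ⟨b, t.2.2⟩) := by
    have hp (q : Q) : IsPath trans ⟨b, (H b).start⟩ r q ↔ _ :=
      isPath_image_iff (E := (H b).trans) (φ := fun q => (⟨b, q⟩ : Q))
        (by
          intro s a y
          constructor
          · rintro ⟨b, x, l, y, h, h'⟩
            cases h'
            exact ⟨y, rfl, h⟩
          · rintro ⟨t, rfl, h⟩
            exact ⟨b, s, a, t, h, rfl⟩)
    constructor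
    · rintro ⟨⟨q, hq, h⟩, rfl, rfl⟩
      obtain ⟨r', t, rfl, rfl, h'⟩ := (hp q).1 h
      exact ⟨r', ⟨⟨t, hq, h'⟩, by simp [List.filterMap_map],
        by simp [List.filterMap_map]⟩, rfl⟩
    · rintro ⟨r', ⟨⟨t, ht, h⟩, rfl, rfl⟩, rfl⟩
      exact ⟨⟨_, ht, (hp _).2 ⟨r', t, rfl, rfl, h⟩⟩,
        by simp [List.filterMap_map],
        by simp [List.filterMap_map]⟩
  refine ⟨Q, inferInstance, fun a => ⟨e a, (H (e a)).start⟩, final, trans, ?_, ?_⟩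
  · intro a b h
    exact e.injective (congrArg Sigma.fst h)
  · intro σ τ A B
    have hT (a : α) : Cascade.graph ⟨final, trans, A, B⟩ (fun a => ⟨e a, (H (e a)).start⟩) a
      = T (e a) := rfl
    have hG (a : α) : H (e a) = G a := by simp [H]
    constructor
    · ext ⟨x, a, y⟩
      change (∃ r, (T (e a)).AcceptingRun x y r) ↔ ∃ r, (G a).AcceptingRun x y r
      rw [← hG]
      simp_rw [key]
      exact ⟨fun ⟨_, r, h, _⟩ => ⟨r, h⟩, fun ⟨r, h⟩ => ⟨_, r, h, rfl⟩⟩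
    · intro hu a x y
      rw [hT]
      rintro ⟨r, hr⟩
      refine ⟨r, hr, fun r' hr' => ?_⟩
      obtain ⟨s, hs, rfl⟩ := (key ..).1 hr
      obtain ⟨s', hs', rfl⟩ := (key ..).1 hr'
      rw [((hG a).symm ▸ hu a : (H (e a)).Unambiguous) x y ⟨s, hs⟩ |>.unique hs hs']

end Uniform

/-! ### Conclusion of the direction from graphs to machines. -/

theorem isUnambiguousContextSensitive_pathLanguage {α : Type*} [Finite α] {Γ : Type} [Finite Γ]
    (G : RationalGraph α Γ) {I F : Language Γ} (hI : I.IsRegular) (hF : F.IsRegular)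
    (hT : ∀ a, (G a).Unambiguous) (hG : GraphUnambiguous G.edges I F) :
    IsUnambiguousContextSensitive (pathLanguage G.edges I F) := by
  obtain ⟨σ, _, A, rfl⟩ := hI
  obtain ⟨τ, _, B, rfl⟩ := hF
  obtain ⟨Q, _, st, final, trans, hst, h⟩ := exists_cascade G
  let D : Cascade Γ Q σ τ := ⟨final, trans, A, B⟩
  obtain ⟨hE, hU⟩ := h σ τ A B
  rw [← hE] at hG ⊢
  refine ⟨?_, D.machine st hst, D.machine_linearSpace st hst,
    D.machine_unambiguous st hst (hU hT) hG, D.machine_language st hst⟩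
  rintro ⟨p, hp, h, -⟩
  exact hp (List.map_eq_nil_iff.1 h)


/-! ### Letter-to-letter transducers and automata checking windows -/

section Window

variable {X : Type}

/-- All the windows of the pair of words `(x :: u, y :: v)` of equal lengths satisfy `step`, and its
last letters satisfy `final`. -/
def WindowFrom (step : X → X → X → X → Prop) (final : X → X → Prop) :
    X → X → List X → List X → Prop
  | x, y, [], [] => final x y
  | x, y, x' :: u, y' :: v => step x y x' y' ∧ WindowFrom step final x' y' u v
  | _, _, _, _ => False

/-- The words have equal positive lengths, their first letters satisfy `init`, their windows `step`
and their last letters `final`. -/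
def Window (init : X → X → Prop) (step : X → X → X → X → Prop) (final : X → X → Prop) :
    List X → List X → Prop
  | x :: u, y :: v => init x y ∧ WindowFrom step final x y u v
  | _, _ => False

/-- The transducer accepting the pairs of words satisfying `Window init step final`. -/
def windowTransducer [Finite X] (init : X → X → Prop) (step : X → X → X → X → Prop)
    (final : X → X → Prop) : Transducer X where
  Q := Option (X × X)
  finQ := inferInstance
  start := none
  final := {s | ∃ x y, s = some (x, y) ∧ final x y}
  trans := {e | ∃ x' y', e.2 = ((some x', some y'), some (x', y')) ∧
    ((e.1 = none ∧ init x' y') ∨ ∃ x y, e.1 = some (x, y) ∧ step x y x' y')}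

/-- The only possible run of a window transducer on a pair of words. -/
def windowRun : Option (X × X) → List X → List X →
    List (Option (X × X) × (Option X × Option X) × Option (X × X))
  | s, x :: u, y :: v => (s, (some x, some y), some (x, y)) :: windowRun (some (x, y)) u v
  | _, _, _ => []

variable [Finite X] {init : X → X → Prop} {step : X → X → X → X → Prop} {final : X → X → Prop}

theorem eq_windowRun {s t : Option (X × X)}
    {r : List (Option (X × X) × (Option X × Option X) × Option (X × X))}
    (h : IsPath (windowTransducer init step final).trans s r t) :
    r = windowRun s (r.filterMap fun e => e.2.1.1) (r.filterMap fun e => e.2.1.2) := by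
  induction r generalizing s with
  | nil => rfl
  | cons e r ih =>
    obtain ⟨s, l, s'⟩ := e
    obtain ⟨⟨x, y, he, -⟩, rfl, h⟩ := h
    cases he
    exact congrArg _ (ih h)

/-- Each transition reads and writes one letter, and its target state is this pair of letters; so
the words determine the run. -/
theorem windowTransducer_unambiguous : (windowTransducer init step final).Unambiguous := by
  rintro u v ⟨r, hr⟩
  have key : ∀ r', (windowTransducer init step final).AcceptingRun u v r' →
      r' = windowRun none u v := by
    rintro r' ⟨⟨q, _, h⟩, rfl, rfl⟩
    exact eq_windowRun h
  exact ⟨r, hr, fun r' hr' => (key r' hr').trans (key r hr).symm⟩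

theorem exists_isPath_some_iff {x y : X} {u v : List X} :
    (∃ r, (∃ q ∈ (windowTransducer init step final).final,
      IsPath (windowTransducer init step final).trans (some (x, y)) r q) ∧
      r.filterMap (fun e => e.2.1.1) = u ∧ r.filterMap (fun e => e.2.1.2) = v) ↔
    WindowFrom step final x y u v := by
  constructor
  · rintro ⟨r, ⟨q, hq, h⟩, rfl, rfl⟩
    induction r generalizing x y with
    | nil =>
      obtain ⟨x', y', rfl, hf⟩ := hq
      cases h
      exact hf
    | cons e r ih =>
      obtain ⟨s, l, s'⟩ := e
      obtain ⟨⟨x', y', he, hs⟩, h', h⟩ := h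
      cases he
      cases h'
      obtain ⟨h', -⟩ | ⟨x₁, y₁, h', hs⟩ := hs
      · cases h'
      · cases h'
        exact ⟨hs, ih h⟩
  · intro h
    induction u generalizing x y v with
    | nil =>
      cases v with
      | nil => exact ⟨[], ⟨_, ⟨x, y, rfl, h⟩, rfl⟩, rfl, rfl⟩
      | cons y' v => exact h.elim
    | cons x' u ih =>
      cases v with
      | nil => exact h.elim
      | cons y' v =>
        obtain ⟨r, ⟨q, hq, hr⟩, rfl, rfl⟩ := ih h.2
        exact ⟨(some (x, y), (some x', some y'), some (x', y')) :: r,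
          ⟨q, hq, ⟨x', y', rfl, .inr ⟨x, y, rfl, h.1⟩⟩, rfl, hr⟩, rfl, rfl⟩

theorem windowTransducer_accepts_iff {u v : List X} :
    (windowTransducer init step final).Accepts u v ↔ Window init step final u v := by
  constructor
  · rintro ⟨_ | ⟨⟨s, l, s'⟩, r⟩, ⟨q, hq, h⟩, rfl, rfl⟩
    · obtain ⟨x, y, rfl, -⟩ := hq
      cases h
    · obtain ⟨⟨x', y', he, hs⟩, h', h⟩ := h
      cases he
      cases h'
      obtain ⟨-, hs⟩ | ⟨x₁, y₁, h', -⟩ := hs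
      · exact ⟨hs, exists_isPath_some_iff.1 ⟨r, ⟨q, hq, h⟩, rfl, rfl⟩⟩
      · cases h'
  · intro h
    rcases u with _ | ⟨x, u⟩
    · exact h.elim
    rcases v with _ | ⟨y, v⟩
    · exact h.elim
    obtain ⟨r, ⟨q, hq, hr⟩, rfl, rfl⟩ :=
      (exists_isPath_some_iff (init := init) (step := step) (final := final)).2 h.2
    exact ⟨(none, (some x, some y), some (x, y)) :: r,
      ⟨q, hq, ⟨x, y, rfl, .inl ⟨rfl, h.1⟩⟩, rfl, hr⟩, rfl, rfl⟩

/-- Successive letters of `x :: u` satisfy `step` and its last letter satisfies `final`. -/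
def ColumnFrom (step : X → X → Prop) (final : X → Prop) : X → List X → Prop
  | x, [] => final x
  | x, x' :: u => step x x' ∧ ColumnFrom step final x' u

/-- The language of the words whose first letter satisfies `init`, successive letters `step`, and
last letter `final`. -/
def columnLanguage (init : X → Prop) (step : X → X → Prop) (final : X → Prop) : Language X :=
  {u | ∃ x u', u = x :: u' ∧ init x ∧ ColumnFrom step final x u'}

omit [Finite X] in
theorem nil_notMem_columnLanguage {init : X → Prop} {step : X → X → Prop} {final : X → Prop} :
    [] ∉ columnLanguage init step final := by
  rintro ⟨x, u, h, -⟩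
  cases h

omit [Finite X] in
theorem cons_mem_columnLanguage_iff {init : X → Prop} {step : X → X → Prop} {final : X → Prop}
    {x : X} {u : List X} :
    x :: u ∈ columnLanguage init step final ↔ init x ∧ ColumnFrom step final x u := by
  constructor
  · rintro ⟨x', u', h, h'⟩
    cases h
    exact h'
  · exact fun h => ⟨x, u, rfl, h⟩

theorem columnLanguage_isRegular (init : X → Prop) (step : X → X → Prop) (final : X → Prop) :
    (columnLanguage init step final).IsRegular := by
  -- The state holds the last letter read and whether all the checks so far have succeeded.
  let A : DFA X (Option X × Prop) :=
    { step := fun s x => (some x, s.2 ∧ s.1.elim (init x) (step · x))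
      start := (none, True)
      accept := {s | s.2 ∧ ∃ x, s.1 = some x ∧ final x} }
  have key (x : X) (P : Prop) (u : List X) :
      A.evalFrom (some x, P) u ∈ A.accept ↔ P ∧ ColumnFrom step final x u := by
    induction u generalizing x P with
    | nil => simp [A, ColumnFrom]
    | cons x' u ih =>
      rw [DFA.evalFrom_cons]
      refine (ih x' _).trans ?_
      simp [ColumnFrom, and_assoc]
  refine ⟨_, Fintype.ofFinite _, A, ?_⟩
  ext u
  rw [DFA.mem_accepts]
  cases u with
  | nil => exact iff_of_false (by simp [DFA.eval, A]) nil_notMem_columnLanguage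
  | cons x u =>
    rw [DFA.eval, DFA.evalFrom_cons]
    refine (key x _ u).trans ?_
    rw [cons_mem_columnLanguage_iff]
    simp [A]

end Window

/-! ### Paths given by their vertices -/

section PathOf

variable {V A : Type*} {E : Set (V × A × V)}

/-- The sequence of edges through the vertices `f 0, f 1, …` labelled by the given word. -/
def pathOf (f : ℕ → V) : List A → List (V × A × V)
  | [] => []
  | a :: w => (f 0, a, f 1) :: pathOf (fun j => f (j + 1)) w

theorem map_pathOf (f : ℕ → V) (w : List A) : (pathOf f w).map (fun e => e.2.1) = w := by
  induction w generalizing f with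
  | nil => rfl
  | cons a w ih => exact congrArg _ (ih _)

theorem pathOf_congr {f g : ℕ → V} {w : List A} (h : ∀ j ≤ w.length, f j = g j) :
    pathOf f w = pathOf g w := by
  induction w generalizing f g with
  | nil => rfl
  | cons a w ih =>
    rw [pathOf, pathOf, h 0 (by simp), h 1 (by simp),
      ih fun j hj => h (j + 1) (by simpa using hj)]

theorem isPath_pathOf_iff {f : ℕ → V} {w : List A} :
    IsPath E (f 0) (pathOf f w) (f w.length) ↔
      ∀ j (hj : j < w.length), (f j, w[j], f (j + 1)) ∈ E := by
  induction w generalizing f with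
  | nil => simp [pathOf, IsPath]
  | cons a w ih =>
    have := ih (f := fun j => f (j + 1))
    simp only [pathOf, isPath_cons, true_and, List.length_cons]
    rw [this]
    constructor
    · rintro ⟨h₀, h⟩ (_ | j) hj
      · exact h₀
      · exact h j (by simpa using hj)
    · intro h
      exact ⟨h 0 (by simp), fun j hj => h (j + 1) (by simpa using hj)⟩

theorem IsPath.exists_eq_pathOf {s t : V} {p : List (V × A × V)} (h : IsPath E s p t) :
    ∃ f : ℕ → V, f 0 = s ∧ f p.length = t ∧ p = pathOf f (p.map fun e => e.2.1) := by
  induction p generalizing s with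
  | nil => exact ⟨fun _ => s, rfl, h, rfl⟩
  | cons e p ih =>
    obtain ⟨-, rfl, h⟩ := h
    obtain ⟨f, h₀, h₁, h₂⟩ := ih h
    refine ⟨fun j => Nat.casesOn j e.1 f, rfl, h₁, ?_⟩
    change e :: p = (e.1, e.2.1, f 0) :: pathOf f (p.map fun e => e.2.1)
    rw [← h₂, h₀]

end PathOf

/-! ### The history of the tape as a path of a rational graph

The tape is folded into `n + 1` columns, where `n` is the length of the input: column `j` holds
the cells congruent to `j` modulo `n + 1`. The vertices are the histories of the columns. -/

instance : Finite Move := by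
  refine Finite.of_injective (β := Option Bool) (fun m => match m with
    | .left => none
    | .stay => some true
    | .right => some false) ?_
  rintro (_ | _ | _) (_ | _ | _) h <;> first | rfl | simp at h

namespace Machine

variable {α : Type*} (M : Machine α)

/-- The contents of a column at a given time, together with the state, the track of the head and the
next move; `head` tells whether the head is in this column. -/
@[ext] structure Letter (N : ℕ) : Type where
  cells : ZMod N → M.Γ
  head : Prop
  state : M.Q
  track : ZMod N
  move : Move

instance (N : ℕ) [NeZero N] : Finite (M.Letter N) := by
  have := M.finΓ
  have := M.finQ
  refine Finite.of_injective (fun x : M.Letter N => (x.cells, x.head, x.state, x.track, x.move)) ?_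
  intro x y h
  simp only [Prod.mk.injEq] at h
  exact Letter.ext h.1 h.2.1 h.2.2.1 h.2.2.2.1 h.2.2.2.2

variable {M} {N : ℕ}

namespace Letter

/-- The evolution of a column in one step. -/
def Evolves (x x' : M.Letter N) : Prop :=
  (x.head → ∃ b, (x'.state, b, x.move) ∈ M.trans x.state (x.cells x.track) ∧
    x'.cells = Function.update x.cells x.track b) ∧
  (¬ x.head → x'.cells = x.cells)

/-- The condition on the first column in one step. -/
def SourceStep (x x' : M.Letter N) : Prop :=
  Evolves x x' ∧ match x.move with
  | .stay => x'.track = x.track ∧ (x'.head ↔ x.head)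
  | .right => (x'.head → x'.track = x.track + 1) ∧ (¬ x'.head → x'.track = x.track)
  | .left => (x.head → x'.track = x.track - 1) ∧ (¬ x.head → x'.track = x.track)

/-- The condition on the last column in one step. -/
def TargetStep (y y' : M.Letter N) : Prop :=
  match y.move with
  | .stay => True
  | .right => (y.head → y'.track = y.track + 1) ∧ (¬ y.head → y'.track = y.track)
  | .left => (y'.head → y'.track = y.track - 1) ∧ (¬ y'.head → y'.track = y.track)

/-- The letters agree on the state, the track and the move. -/
def Agree (x y : M.Letter N) : Prop :=
  y.state = x.state ∧ y.track = x.track ∧ y.move = x.move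

/-- The condition on two neighbouring columns in one step. -/
def PairStep (x y x' y' : M.Letter N) : Prop :=
  Evolves y y' ∧ Agree x' y' ∧ match x.move with
  | .stay => (y'.head ↔ y.head)
  | .right => (y'.head ↔ x.head)
  | .left => (x'.head ↔ y.head)

/-- The initial condition on the first column. -/
def SourceInit (x : M.Letter N) : Prop := x.head ∧ x.state = M.start ∧ x.track = 0

/-- The initial condition on two neighbouring columns, the first of which holds the letter `a`. -/
def PairInit (a : α) (x y : M.Letter N) : Prop :=
  Agree x y ∧ x.cells = Function.update (fun _ => M.blank) 0 (M.input a) ∧ ¬ y.head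

/-- The initial condition on the last column. -/
def TargetInit (y : M.Letter N) : Prop := y.cells = fun _ => M.blank

/-- The final condition on the first column. -/
def SourceFinal (x : M.Letter N) : Prop := x.state ∈ M.accept ∧ x.move = .stay

end Letter

open Letter

/-! ### Arithmetic of the folded tape. -/

/-- The letter of column `j` in the configuration `c`, when the tape is folded into `n + 1` columns
and the next move is `m`. -/
def view (N n : ℕ) (c : M.Config) (m : Move) (j : ℕ) : M.Letter N where
  cells := fun μ => c.tape (μ.valMinAbs * (n + 1) + j)
  head := c.head % (n + 1) = j
  state := c.state
  track := (c.head / (n + 1) : ℤ)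
  move := m

/-- The space bound puts the track of the head in `[-k, k]`, where `valMinAbs` modulo `2 * k + 3`
recovers an integer from its residue. -/
theorem cell_eq_iff {k n : ℕ} {h : ℤ} (hh : |h| ≤ k * (n + 1)) (μ : ZMod (2 * k + 3)) {j : ℕ}
    (hj : j ≤ n) : μ.valMinAbs * (n + 1) + j = h ↔
      h % (n + 1) = j ∧ μ = ((h / (n + 1) : ℤ) : ZMod (2 * k + 3)) := by
  have hd : (0 : ℤ) < n + 1 := by positivity
  constructor
  · rintro rfl
    have h₁ : (j : ℤ) % (n + 1) = j := Int.emod_eq_of_lt (by positivity) (by omega)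
    have h₂ : (j : ℤ) / (n + 1) = 0 := Int.ediv_eq_zero_of_lt (by positivity) (by omega)
    rw [Int.add_comm, Int.add_mul_emod_self_right, Int.add_mul_ediv_right _ _ hd.ne', h₁, h₂]
    simp
  · rintro ⟨h₁, rfl⟩
    rw [abs_le] at hh
    have h₂ : h / (n + 1) ≤ k := Int.ediv_le_of_le_mul hd hh.2
    have h₃ : -(k : ℤ) ≤ h / (n + 1) := by
      rw [Int.le_ediv_iff_mul_le hd]
      linarith
    rw [(ZMod.valMinAbs_spec _ (h / (n + 1))).2 ⟨rfl, by push_cast; omega, by push_cast; omega⟩,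
      ← h₁, mul_comm]
    exact Int.mul_ediv_add_emod h (n + 1)

/-- A move to the right wraps to column `0` of the next track or stays on its track. Moves to the
left are treated by applying this at the head position minus one. -/
theorem emod_ediv_succ {n : ℕ} (h : ℤ) :
    (h % (n + 1) = n → (h + 1) % (n + 1) = 0 ∧ (h + 1) / (n + 1) = h / (n + 1) + 1) ∧
    (h % (n + 1) ≠ n →
      (h + 1) % (n + 1) = h % (n + 1) + 1 ∧ (h + 1) / (n + 1) = h / (n + 1)) := by
  have hd : (0 : ℤ) < n + 1 := by positivity
  have h₀ := Int.mul_ediv_add_emod h (n + 1)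
  have h₁ := Int.emod_nonneg h hd.ne'
  have h₂ := Int.emod_lt_of_pos h hd
  set q := h / (n + 1)
  set r := h % (n + 1)
  constructor
  · intro hr
    have : h + 1 = 0 + (q + 1) * (n + 1) := by rw [← h₀, hr]; ring
    rw [this, Int.add_mul_emod_self_right, Int.add_mul_ediv_right _ _ hd.ne']
    simp
  · intro hr
    have : h + 1 = (r + 1) + q * (n + 1) := by rw [← h₀]; ring
    rw [this, Int.add_mul_emod_self_right, Int.add_mul_ediv_right _ _ hd.ne',
      Int.emod_eq_of_lt (by omega) (by omega), Int.ediv_eq_zero_of_lt (by omega) (by omega)]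
    simp

/-! ### One machine step as a condition on adjacent columns. -/

/-- The move of the head between two configurations. -/
def moveBetween (c c' : M.Config) : Move :=
  if c'.head = c.head then .stay else if c'.head < c.head then .left else .right

theorem moveBetween_eq {c c' : M.Config} {m : Move} (h : c'.head = c.head + m.shift) :
    moveBetween c c' = m := by
  cases m <;> simp [moveBetween, h, Move.shift]

/-- The conditions on all the columns in one step. -/
def RowStep (n : ℕ) (x x' : ℕ → M.Letter N) : Prop :=
  SourceStep (x 0) (x' 0) ∧ (∀ j < n, PairStep (x j) (x (j + 1)) (x' j) (x' (j + 1))) ∧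
    TargetStep (x n) (x' n)

theorem evolves_view {k n : ℕ} {c : M.Config} (hc : |c.head| ≤ k * (n + 1))
    {t : M.Q × M.Γ × Move} (ht : t ∈ M.trans c.state (c.tape c.head)) (m : Move) {j : ℕ}
    (hj : j ≤ n) :
    Evolves (view (2 * k + 3) n c t.2.2 j)
      (view (2 * k + 3) n ⟨t.1, c.head + t.2.2.shift, Function.update c.tape c.head t.2.1⟩ m j) := by
  constructor
  · intro hd
    have hd' : c.head % (n + 1) = j := hd
    refine ⟨t.2.1, ?_, ?_⟩
    · have := (cell_eq_iff hc ((c.head / (n + 1) : ℤ) : ZMod (2 * k + 3)) hj).2 ⟨hd', rfl⟩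
      simpa only [view, this] using ht
    · ext1 μ
      by_cases hμ : μ = ((c.head / (n + 1) : ℤ) : ZMod (2 * k + 3))
      · simp only [view, (cell_eq_iff hc μ hj).2 ⟨hd', hμ⟩, ← hμ, Function.update_self]
      · have := fun h => hμ ((cell_eq_iff hc μ hj).1 h).2
        simp only [view, Function.update_of_ne this, Function.update_of_ne hμ]
  · intro hd
    ext1 μ
    have := fun h => hd ((cell_eq_iff hc μ hj).1 h).1
    simp only [view, Function.update_of_ne this]

theorem rowStep_view {k n : ℕ} {c c' : M.Config} (hc : |c.head| ≤ k * (n + 1))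
    (h : M.Step c c') (m : Move) :
    RowStep n (view (2 * k + 3) n c (moveBetween c c')) (view (2 * k + 3) n c' m) := by
  obtain ⟨t, ht, rfl⟩ := h
  rw [moveBetween_eq (m := t.2.2) rfl]
  have hev (j : ℕ) (hj : j ≤ n) := evolves_view hc ht m hj
  obtain ⟨h₁, h₂⟩ := emod_ediv_succ (n := n) c.head
  obtain ⟨h₃, h₄⟩ := emod_ediv_succ (n := n) (c.head - 1)
  have hd : (0 : ℤ) < n + 1 := by positivity
  have hpos := Int.emod_nonneg c.head hd.ne'
  have hpos' := Int.emod_nonneg (c.head - 1) hd.ne'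
  rw [sub_add_cancel] at h₃ h₄
  obtain ⟨q, b, v⟩ := t
  refine ⟨⟨hev 0 n.zero_le, ?_⟩, fun j hj => ⟨hev (j + 1) hj, ⟨rfl, rfl, rfl⟩, ?_⟩, ?_⟩ <;>
    clear hev ht <;> cases v <;>
    simp only [view, TargetStep, Move.shift, add_zero, Nat.cast_zero, Nat.cast_add, Nat.cast_one,
      ← sub_eq_add_neg, and_self]
  · constructor <;> intro h
    · rw [(h₃ (by by_contra hr; have := h₄ hr; omega)).2]
      push_cast
      ring
    · rw [(h₄ (by intro hr; exact h (h₃ hr).1)).2]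
  · constructor <;> intro h
    · rw [(h₁ (by by_contra hr; have := h₂ hr; omega)).2]
      push_cast
      ring
    · rw [(h₂ (by intro hr; exact h (h₁ hr).1)).2]
  · by_cases hr : (c.head - 1) % (n + 1) = n
    · have := h₃ hr
      omega
    · have := h₄ hr
      omega
  · by_cases hr : c.head % (n + 1) = n
    · have := h₁ hr
      omega
    · have := h₂ hr
      omega
  · constructor <;> intro hr
    · rw [(h₃ hr).2]
      push_cast
      ring
    · rw [(h₄ hr).2]
  · constructor <;> intro hr
    · rw [(h₁ hr).2]
      push_cast
      ring
    · rw [(h₂ hr).2]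

/-- The column holding the head supplies the transition, and `Agree` spreads the new state, track
and move to all columns. `PairStep` places the head everywhere except in column `0` after a right
move and in column `n` after a left move; there the track conditions of the first and last columns
decide. -/
theorem exists_step_of_rowStep {k n : ℕ} {c : M.Config} (hc : |c.head| ≤ k * (n + 1)) {m : Move}
    {x : ℕ → M.Letter (2 * k + 3)} (h : RowStep n (view (2 * k + 3) n c m) x) :
    ∃ c', M.Step c c' ∧ moveBetween c c' = m ∧
      ∀ j ≤ n, x j = view (2 * k + 3) n c' (x 0).move j := by
  obtain ⟨⟨hev₀, hs⟩, hp, ht⟩ := h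
  have hagree (j : ℕ) (hj : j ≤ n) : Agree (x 0) (x j) := by
    induction j with
    | zero => exact ⟨rfl, rfl, rfl⟩
    | succ j ih =>
      obtain ⟨h₁, h₂, h₃⟩ := ih (by omega)
      obtain ⟨h₁', h₂', h₃'⟩ := (hp j hj).2.1
      exact ⟨h₁'.trans h₁, h₂'.trans h₂, h₃'.trans h₃⟩
  have hev (j : ℕ) (hj : j ≤ n) : Evolves (view (2 * k + 3) n c m j) (x j) := by
    cases j with
    | zero => exact hev₀
    | succ j => exact (hp j hj).1
  have hd : (0 : ℤ) < n + 1 := by positivity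
  have hpos := Int.emod_nonneg c.head hd.ne'
  have hlt := Int.emod_lt_of_pos c.head hd
  obtain ⟨j₀, hj₀⟩ := Int.eq_ofNat_of_zero_le hpos
  have hj₀n : j₀ ≤ n := by omega
  obtain ⟨b, hb, hcells⟩ := (hev j₀ hj₀n).1 hj₀
  rw [(hagree j₀ hj₀n).1] at hb
  have htr : ((x 0).state, b, m) ∈ M.trans c.state (c.tape c.head) := by
    have := (cell_eq_iff hc ((c.head / (n + 1) : ℤ) : ZMod (2 * k + 3)) hj₀n).2 ⟨hj₀, rfl⟩
    simpa only [view, this] using hb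
  set c' : M.Config := ⟨(x 0).state, c.head + m.shift, Function.update c.tape c.head b⟩ with hc'
  refine ⟨c', ⟨_, htr, rfl⟩, moveBetween_eq rfl, ?_⟩
  have hcell (j : ℕ) (hj : j ≤ n) :
      (x j).cells = (view (2 * k + 3) n c' (x 0).move j).cells := by
    have he := evolves_view hc htr (x 0).move hj
    by_cases hh : c.head % (n + 1) = j
    · obtain rfl : j = j₀ := by exact_mod_cast hh.symm.trans hj₀
      rw [hcells]
      ext1 μ
      by_cases hμ : μ = ((c.head / (n + 1) : ℤ) : ZMod (2 * k + 3))
      · simp only [view, hc', (cell_eq_iff hc μ hj).2 ⟨hh, hμ⟩, ← hμ, Function.update_self]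
      · have := fun h => hμ ((cell_eq_iff hc μ hj).1 h).2
        simp only [view, hc', Function.update_of_ne this, Function.update_of_ne hμ]
    · exact ((hev j hj).2 hh).trans (he.2 hh).symm
  have htrack : (x n).track = (x 0).track := (hagree n le_rfl).2.1
  -- A changed track is visible because the modulus exceeds `1`, even for `k = 0`.
  have hne (a : ZMod (2 * k + 3)) : a + 1 ≠ a := by
    have : Fact (1 < 2 * k + 3) := ⟨by omega⟩
    simp
  obtain ⟨h₁, h₂⟩ := emod_ediv_succ (n := n) c.head
  obtain ⟨h₃, h₄⟩ := emod_ediv_succ (n := n) (c.head - 1)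
  have hpos' := Int.emod_nonneg (c.head - 1) hd.ne'
  rw [sub_add_cancel] at h₃ h₄
  have hhead : (∀ j ≤ n, (x j).head ↔ c'.head % (n + 1) = j) ∧
      (x 0).track = ((c'.head / (n + 1) : ℤ) : ZMod (2 * k + 3)) := by
    obtain hh : c'.head = c.head + m.shift := rfl
    rw [hh]
    clear hh hc' c' hcell htr hcells hev hb hev₀ hagree
    cases m <;>
      simp only [view, TargetStep, Move.shift, add_zero, Nat.cast_zero, ← sub_eq_add_neg,
        htrack] at hs ht ⊢
    · have hp' (j : ℕ) (hj : j < n) : (x j).head ↔ c.head % (n + 1) = (j + 1 : ℕ) := (hp j hj).2.2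
      by_cases hr : (c.head - 1) % (n + 1) = n
      · obtain ⟨hr₁, hr₂⟩ := h₃ hr
        have htr := hs.1 hr₁
        refine ⟨fun j hj => ?_, by rw [htr, hr₂]; push_cast; ring⟩
        rcases hj.lt_or_eq with hj | rfl
        · rw [hp' j hj]
          omega
        · refine iff_of_true ?_ hr
          -- Otherwise the last column would keep the track that the first column decreases.
          by_contra hx
          exact hne _ (sub_eq_iff_eq_add.1 (htr.symm.trans (ht.2 hx))).symm
      · obtain ⟨hr₁, hr₂⟩ := h₄ hr
        have htr := hs.2 (by omega)
        refine ⟨fun j hj => ?_, by rw [htr, hr₂]⟩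
        rcases hj.lt_or_eq with hj | rfl
        · rw [hp' j hj]
          omega
        · refine iff_of_false (fun hx => ?_) hr
          exact hne _ (sub_eq_iff_eq_add.1 ((ht.1 hx).symm.trans htr)).symm
    · refine ⟨fun j hj => ?_, hs.1⟩
      cases j with
      | zero => exact hs.2
      | succ j => exact (hp j hj).2.2
    · have hp' (j : ℕ) (hj : j < n) : (x (j + 1)).head ↔ c.head % (n + 1) = j := (hp j hj).2.2
      by_cases hr : c.head % (n + 1) = n
      · obtain ⟨hr₁, hr₂⟩ := h₁ hr
        have htr := ht.1 hr
        refine ⟨fun j hj => ?_, by rw [htr, hr₂]; push_cast; rfl⟩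
        rcases j with _ | j
        · refine iff_of_true ?_ hr₁
          -- Otherwise the first column would keep the track that the last column increases.
          by_contra hx
          exact hne _ (htr.symm.trans (hs.2 hx))
        · rw [hp' j hj]
          omega
      · obtain ⟨hr₁, hr₂⟩ := h₂ hr
        have htr := ht.2 hr
        refine ⟨fun j hj => ?_, by rw [htr, hr₂]⟩
        rcases j with _ | j
        · refine iff_of_false (fun hx => ?_) (by omega)
          exact hne _ ((hs.1 hx).symm.trans htr)
        · rw [hp' j hj]
          omega
  intro j hj
  obtain ⟨hst, htk, hmv⟩ := hagree j hj
  exact Letter.ext (hcell j hj) (propext (hhead.1 j hj)) (hst.trans (by rw [hc']; rfl))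
    (htk.trans hhead.2) hmv

/-! ### Whole computations as families of columns. -/

/-- The next move in the computation `r` from `c`. -/
def nextMove (c : M.Config) : List M.Config → Move
  | [] => .stay
  | c' :: _ => moveBetween c c'

/-- The history of column `j` in a computation. -/
def column (N n j : ℕ) : List M.Config → List (M.Letter N)
  | [] => []
  | c :: r => view N n c (nextMove c r) j :: column N n j r

/-- The conditions on the columns `x 0 :: s 0, …, x n :: s n`. -/
def Columns (n : ℕ) (x : ℕ → M.Letter N) (s : ℕ → List (M.Letter N)) : Prop :=
  ColumnFrom SourceStep SourceFinal (x 0) (s 0) ∧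
  (∀ j < n, WindowFrom PairStep Agree (x j) (x (j + 1)) (s j) (s (j + 1))) ∧
  ColumnFrom TargetStep (fun _ => True) (x n) (s n)

theorem columns_nil_iff {n : ℕ} {x : ℕ → M.Letter N} {s : ℕ → List (M.Letter N)}
    (hs : ∀ j ≤ n, s j = []) :
    Columns n x s ↔ SourceFinal (x 0) ∧ ∀ j < n, Agree (x j) (x (j + 1)) := by
  rw [Columns, hs 0 n.zero_le, hs n le_rfl]
  simp only [ColumnFrom, and_true]
  refine and_congr_right fun _ => forall₂_congr fun j hj => ?_
  rw [hs j hj.le, hs (j + 1) hj]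
  rfl

theorem columns_cons_iff {n : ℕ} {x x' : ℕ → M.Letter N} {s s' : ℕ → List (M.Letter N)}
    (hs : ∀ j ≤ n, s j = x' j :: s' j) :
    Columns n x s ↔ RowStep n x x' ∧ Columns n x' s' := by
  have h (j : ℕ) (hj : j < n) : WindowFrom PairStep Agree (x j) (x (j + 1)) (s j) (s (j + 1)) ↔
      PairStep (x j) (x (j + 1)) (x' j) (x' (j + 1)) ∧
      WindowFrom PairStep Agree (x' j) (x' (j + 1)) (s' j) (s' (j + 1)) := by
    rw [hs j hj.le, hs (j + 1) hj]
    rfl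
  rw [Columns, forall₂_congr h, hs 0 n.zero_le, hs n le_rfl]
  simp only [ColumnFrom, Columns, RowStep, forall_and]
  tauto

theorem columns_of_runFrom {k n : ℕ} {c₀ c : M.Config}
    (hk : ∀ c, Relation.ReflTransGen M.Step c₀ c → |c.head| ≤ k * (n + 1))
    (hc : Relation.ReflTransGen M.Step c₀ c) {r : List M.Config} (h : M.RunFrom c r) :
    Columns n (view (2 * k + 3) n c (nextMove c r)) (fun j => column (2 * k + 3) n j r) := by
  induction r generalizing c with
  | nil =>
    refine (columns_nil_iff fun _ _ => rfl).2 ?_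
    exact ⟨⟨h, rfl⟩, fun _ _ => ⟨rfl, rfl, rfl⟩⟩
  | cons c' r ih =>
    refine (columns_cons_iff (x' := view _ n c' (nextMove c' r))
      (s' := fun j => column _ n j r) fun _ _ => rfl).2 ?_
    exact ⟨rowStep_view (hk c hc) h.1 _, ih (hc.tail h.1) h.2⟩

/-- All histories end at the same time, which allows decoding by induction on their common length.
-/
theorem Columns.length_eq {n : ℕ} {x : ℕ → M.Letter N} {s : ℕ → List (M.Letter N)}
    (h : Columns n x s) {j : ℕ} (hj : j ≤ n) : (s j).length = (s 0).length := by
  have key (u v : List (M.Letter N)) (x y) (h : WindowFrom PairStep Agree x y u v) :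
      v.length = u.length := by
    induction u generalizing v x y with
    | nil => cases v with
      | nil => rfl
      | cons => exact h.elim
    | cons x' u ih => cases v with
      | nil => exact h.elim
      | cons y' v => exact congrArg (· + 1) (ih v _ _ h.2)
  induction j with
  | zero => rfl
  | succ j ih => exact (key _ _ _ _ (h.2.1 j hj)).trans (ih (by omega))

theorem Columns.congr {n : ℕ} {x x' : ℕ → M.Letter N} {s : ℕ → List (M.Letter N)}
    (h : Columns n x s) (hx : ∀ j ≤ n, x j = x' j) : Columns n x' s := by
  obtain ⟨h₁, h₂, h₃⟩ := h
  refine ⟨hx 0 n.zero_le ▸ h₁, fun j hj => ?_, hx n le_rfl ▸ h₃⟩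
  rw [← hx j hj.le, ← hx (j + 1) hj]
  exact h₂ j hj

/-- Rows are decoded one at a time. Each decoded configuration is reachable, so the space bound
holds at it. The move in the last letters is fixed by `SourceFinal`, which is what makes the
encoding of a computation unique. -/
theorem exists_runFrom_of_columns {k n : ℕ} {c₀ c : M.Config}
    (hk : ∀ c, Relation.ReflTransGen M.Step c₀ c → |c.head| ≤ k * (n + 1))
    (hc : Relation.ReflTransGen M.Step c₀ c) {m : Move}
    {s : ℕ → List (M.Letter (2 * k + 3))} (h : Columns n (view (2 * k + 3) n c m) s) :
    ∃ r, M.RunFrom c r ∧ nextMove c r = m ∧ ∀ j ≤ n, s j = column (2 * k + 3) n j r := by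
  generalize hl : (s 0).length = l
  induction l generalizing c m s with
  | zero =>
    have hs (j : ℕ) (hj : j ≤ n) : s j = [] :=
      List.length_eq_zero_iff.1 ((h.length_eq hj).trans hl)
    obtain ⟨hacc, hm⟩ := ((columns_nil_iff hs).1 h).1
    exact ⟨[], hacc, hm.symm, hs⟩
  | succ l ih =>
    have hs (j : ℕ) : ∃ x' s', j ≤ n → s j = x' :: s' := by
      by_cases hj : j ≤ n
      · obtain ⟨x', s', hs⟩ := List.exists_cons_of_length_eq_add_one ((h.length_eq hj).trans hl)
        exact ⟨x', s', fun _ => hs⟩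
      -- Columns beyond `n` play no role; any value will do.
      · exact ⟨view _ n c m j, [], fun h => absurd h hj⟩
    choose x' s' hs using hs
    obtain ⟨hrow, h'⟩ := (columns_cons_iff hs).1 h
    obtain ⟨c', hstep, hm, hx⟩ := exists_step_of_rowStep (hk c hc) hrow
    obtain ⟨r, hr, hm', hs'⟩ := ih (hc.tail hstep) (h'.congr hx)
      (by rw [hs 0 n.zero_le] at hl; exact Nat.succ.inj hl)
    refine ⟨c' :: r, ⟨hstep, hr⟩, hm, fun j hj => ?_⟩
    rw [hs j hj, hx j hj, hs' j hj, ← hm']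
    rfl

/-- The input fills track `0` of the columns before the last one, and every other cell is blank.
Only the first move is left free. -/
theorem init_iff (w : List α) {k : ℕ} (x : ℕ → M.Letter (2 * k + 3)) :
    (SourceInit (x 0) ∧ (∀ j (hj : j < w.length), PairInit w[j] (x j) (x (j + 1))) ∧
      TargetInit (x w.length)) ↔
    ∃ m, ∀ j ≤ w.length, x j = view (2 * k + 3) w.length (M.initialConfig w) m j := by
  have hd : (0 : ℤ) < w.length + 1 := by positivity
  have hcells (j : ℕ) (hj : j ≤ w.length) (μ : ZMod (2 * k + 3)) :
      (M.initialConfig w).tape (μ.valMinAbs * (w.length + 1) + j) =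
        if μ = 0 then (w.map M.input)[j]?.getD M.blank else M.blank := by
    split_ifs with hμ
    · subst hμ
      simp [initialConfig]
    · simp only [initialConfig]
      split_ifs with hi
      -- Since `j ≤ |w|`, a negative track lies left of cell `0` and a positive one right of the
      -- input.
      · have h₀ : μ.valMinAbs ≠ 0 := by rwa [ne_eq, ZMod.valMinAbs_eq_zero]
        rcases lt_or_gt_of_ne h₀ with h | h
        · exfalso
          nlinarith
        · rw [List.getD_eq_getElem?_getD, List.getElem?_eq_none]
          · rfl
          · have : (w.length : ℤ) + 1 ≤ μ.valMinAbs * (w.length + 1) + j := by nlinarith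
            rw [List.length_map]
            omega
      · rfl
  have hlt (m : Move) (j : ℕ) (hj : j < w.length) :
      (view (2 * k + 3) w.length (M.initialConfig w) m j).cells =
        Function.update (fun _ => M.blank) 0 (M.input w[j]) := by
    ext1 μ
    refine (hcells j hj.le μ).trans ?_
    by_cases hμ : μ = 0 <;> simp [hμ, hj]
  have hle (m : Move) : (view (2 * k + 3) w.length (M.initialConfig w) m w.length).cells =
        fun _ => M.blank := by
    ext1 μ
    refine (hcells _ le_rfl μ).trans ?_
    simp
  constructor
  · rintro ⟨⟨h₁, h₂, h₃⟩, hp, ht⟩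
    refine ⟨(x 0).move, fun j hj => ?_⟩
    have hagree : Agree (x 0) (x j) := by
      induction j with
      | zero => exact ⟨rfl, rfl, rfl⟩
      | succ j ih =>
        obtain ⟨h₁, h₂, h₃⟩ := ih (by omega)
        obtain ⟨h₁', h₂', h₃'⟩ := (hp j hj).1
        exact ⟨h₁'.trans h₁, h₂'.trans h₂, h₃'.trans h₃⟩
    refine Letter.ext ?_ ?_ (hagree.1.trans h₂) (hagree.2.1.trans ?_) hagree.2.2
    · rcases hj.lt_or_eq with hj | rfl
      · exact (hp j hj).2.1.trans (hlt _ j hj).symm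
      · exact ht.trans (hle _).symm
    · refine propext ?_
      cases j with
      | zero => exact iff_of_true h₁ (Int.zero_emod _)
      | succ j =>
        refine iff_of_false (hp j hj).2.2 ?_
        change (0 : ℤ) % (w.length + 1) ≠ (j + 1 : ℕ)
        rw [Int.zero_emod]
        omega
    · rw [h₃]
      simp [view, initialConfig]
  · rintro ⟨m, h⟩
    refine ⟨?_, fun j hj => ⟨?_, ?_, ?_⟩, ?_⟩
    · rw [h 0 (Nat.zero_le _)]
      exact ⟨by simp [view, initialConfig], rfl, by simp [view, initialConfig]⟩
    · rw [h j hj.le, h (j + 1) hj]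
      exact ⟨rfl, rfl, rfl⟩
    · rw [h j hj.le, hlt m j hj]
    · rw [h (j + 1) hj]
      simp only [view, initialConfig, Int.zero_emod]
      omega
    · rw [h _ le_rfl]
      exact hle m

/-! ### Paths of the history graph and accepting computations. -/

/-- The rational graph of the column histories. -/
def historyGraph (M : Machine α) (N : ℕ) [NeZero N] : RationalGraph α (M.Letter N) :=
  fun a => windowTransducer (PairInit a) PairStep Agree

/-- The possible histories of the first column. -/
def sourceLanguage (M : Machine α) (N : ℕ) : Language (M.Letter N) :=
  columnLanguage SourceInit SourceStep SourceFinal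

/-- The possible histories of the last column. -/
def targetLanguage (M : Machine α) (N : ℕ) : Language (M.Letter N) :=
  columnLanguage TargetInit TargetStep fun _ => True

theorem vertices_iff {k : ℕ} {w : List α}
    (hk : ∀ c, Relation.ReflTransGen M.Step (M.initialConfig w) c → |c.head| ≤ k * (w.length + 1))
    (f : ℕ → List (M.Letter (2 * k + 3))) :
    (f 0 ∈ M.sourceLanguage (2 * k + 3) ∧ f w.length ∈ M.targetLanguage (2 * k + 3) ∧
      ∀ j (hj : j < w.length), (f j, w[j], f (j + 1)) ∈ (M.historyGraph (2 * k + 3)).edges) ↔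
    ∃ r, M.RunFrom (M.initialConfig w) r ∧
      ∀ j ≤ w.length, f j = column (2 * k + 3) w.length j (M.initialConfig w :: r) := by
  have hedge (a : α) (u v : List (M.Letter (2 * k + 3))) :
      (u, a, v) ∈ (M.historyGraph (2 * k + 3)).edges ↔ Window (PairInit a) PairStep Agree u v :=
    windowTransducer_accepts_iff
  simp_rw [hedge]
  constructor
  · rintro ⟨hs, ht, hp⟩
    have hf (j : ℕ) : ∃ x s, j ≤ w.length → f j = x :: s := by
      by_cases hj : j ≤ w.length
      · have hne : f j ≠ [] := by
          intro h
          rcases hj.lt_or_eq with hj | rfl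
          · have := hp j hj
            rw [h] at this
            exact this
          · rw [h] at ht
            exact nil_notMem_columnLanguage ht
        obtain ⟨x, s, h⟩ := List.exists_cons_of_ne_nil hne
        exact ⟨x, s, fun _ => h⟩
      · exact ⟨view _ 0 (M.initialConfig w) .stay 0, [], fun h => absurd h hj⟩
    choose x s hf using hf
    rw [hf 0 (Nat.zero_le _)] at hs
    rw [hf _ le_rfl] at ht
    have hs' := cons_mem_columnLanguage_iff.1 hs
    have ht' := cons_mem_columnLanguage_iff.1 ht
    have hp' (j : ℕ) (hj : j < w.length) : Window (PairInit w[j]) PairStep Agree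
        (x j :: s j) (x (j + 1) :: s (j + 1)) := by
      rw [← hf j hj.le, ← hf (j + 1) hj]
      exact hp j hj
    obtain ⟨m, hm⟩ := (init_iff w x).1 ⟨hs'.1, fun j hj => (hp' j hj).1, ht'.1⟩
    have hcol : Columns w.length x s := ⟨hs'.2, fun j hj => (hp' j hj).2, ht'.2⟩
    obtain ⟨r, hr, rfl, hs⟩ := exists_runFrom_of_columns hk .refl (hcol.congr hm)
    refine ⟨r, hr, fun j hj => ?_⟩
    rw [hf j hj, hm j hj, hs j hj]
    rfl
  · rintro ⟨r, hr, hf⟩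
    obtain ⟨h₁, h₂, h₃⟩ := columns_of_runFrom hk .refl hr
    obtain ⟨h₁', h₂', h₃'⟩ := (init_iff w _).2 ⟨nextMove (M.initialConfig w) r, fun _ _ => rfl⟩
    refine ⟨?_, ?_, fun j hj => ?_⟩
    · rw [hf 0 (Nat.zero_le _)]
      exact cons_mem_columnLanguage_iff.2 ⟨h₁', h₁⟩
    · rw [hf _ le_rfl]
      exact cons_mem_columnLanguage_iff.2 ⟨h₃', h₃⟩
    · rw [hf j hj.le, hf (j + 1) hj]
      exact ⟨h₂' j hj, h₂ j hj⟩

/-- The path is a function of the computation, so this gives both the equality of languages and the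
unambiguity of the graph. -/
theorem isPathFor_iff {k : ℕ} {w : List α}
    (hk : ∀ c, Relation.ReflTransGen M.Step (M.initialConfig w) c → |c.head| ≤ k * (w.length + 1))
    (p : List (List (M.Letter (2 * k + 3)) × α × List (M.Letter (2 * k + 3)))) :
    IsPathFor (M.historyGraph (2 * k + 3)).edges (M.sourceLanguage (2 * k + 3))
      (M.targetLanguage (2 * k + 3)) w p ↔
    w ≠ [] ∧ ∃ r, M.RunFrom (M.initialConfig w) r ∧
      p = pathOf (fun j => column (2 * k + 3) w.length j (M.initialConfig w :: r)) w := by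
  constructor
  · rintro ⟨hp, rfl, s, hs, t, ht, h⟩
    refine ⟨by simpa using hp, ?_⟩
    obtain ⟨f, rfl, rfl, hf⟩ := h.exists_eq_pathOf
    rw [← List.length_map (as := p) fun e => e.2.1] at h ht
    -- Only the path argument is replaced, because `p` also occurs in its own label.
    replace h := (congrArg (IsPath _ _ · _) hf).mp h
    obtain ⟨r, hr, hf'⟩ := (vertices_iff hk f).1 ⟨hs, ht, isPath_pathOf_iff.1 h⟩
    exact ⟨r, hr, hf.trans (pathOf_congr hf')⟩
  · rintro ⟨hw, r, hr, rfl⟩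
    obtain ⟨hs, ht, h⟩ := (vertices_iff hk _).2 ⟨r, hr, fun _ _ => rfl⟩
    refine ⟨fun h => hw ?_, map_pathOf _ w, _, hs, _, ht, isPath_pathOf_iff.2 h⟩
    rw [← map_pathOf (fun j => column (2 * k + 3) w.length j (M.initialConfig w :: r)) w, h]
    rfl

end Machine

/-! ### Conclusion of the direction from machines to graphs. -/

theorem IsUnambiguousContextSensitive.exists_rationalGraph {α : Type*} {L : Language α}
    (hL : IsUnambiguousContextSensitive L) :
    ∃ (Γ : Type) (_ : Finite Γ) (G : RationalGraph α Γ) (I F : Language Γ),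
      I.IsRegular ∧ F.IsRegular ∧ (∀ a, (G a).Unambiguous) ∧ GraphUnambiguous G.edges I F ∧
      L = pathLanguage G.edges I F := by
  obtain ⟨hnil, M, ⟨k, hk⟩, hM, rfl⟩ := hL
  rw [Machine.unambiguous_iff] at hM
  refine ⟨M.Letter (2 * k + 3), inferInstance, M.historyGraph _, M.sourceLanguage _,
    M.targetLanguage _, columnLanguage_isRegular _ _ _, columnLanguage_isRegular _ _ _,
    fun a => windowTransducer_unambiguous, ?_, ?_⟩
  · rintro w ⟨p, hp⟩
    refine ⟨p, hp, fun p' hp' => ?_⟩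
    obtain ⟨-, r, hr, rfl⟩ := (Machine.isPathFor_iff (hk w) p).1 hp
    obtain ⟨-, r', hr', rfl⟩ := (Machine.isPathFor_iff (hk w) p').1 hp'
    rw [hM w r r' hr hr']
  · ext w
    rw [Machine.mem_language_iff]
    constructor
    · rintro ⟨r, hr⟩
      refine ⟨_, (Machine.isPathFor_iff (hk w) _).2 ⟨?_, r, hr, rfl⟩⟩
      rintro rfl
      exact hnil ((M.mem_language_iff _).2 ⟨r, hr⟩)
    · rintro ⟨p, hp⟩
      obtain ⟨-, r, hr, -⟩ := (Machine.isPathFor_iff (hk w) p).1 hp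
      exact ⟨r, hr⟩

end RatGraph

theorem mainTheorem6 {α : Type*} [Finite α] (L : Language α) :
    RatGraph.IsUnambiguousContextSensitive L ↔
      ∃ (Γ : Type) (_ : Finite Γ) (G : RatGraph.RationalGraph α Γ) (I F : Language Γ),
        I.IsRegular ∧ F.IsRegular ∧ (∀ a, (G a).Unambiguous) ∧
        RatGraph.GraphUnambiguous G.edges I F ∧
        L = RatGraph.pathLanguage G.edges I F := by
  constructor
  · exact fun h => h.exists_rationalGraph
  · rintro ⟨Γ, _, G, I, F, hI, hF, hT, hG, rfl⟩
    exact RatGraph.isUnambiguousContextSensitive_pathLanguage G hI hF hT hG
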